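/- Let $k\ge 2$ and let $f=[F_0:\dots:F_k]:\mathbb P^k\dashrightarrow\mathbb P^k$ be a dominating meromorphic self-map of complex projective space, where $F_0,\dots,F_k$ are homogeneous polynomials of the same degree without nontrivial common factor whose Jacobian determinant does not vanish identically. Let $I(f)=\{F_0=\dots=F_k=0\}$ be its indeterminacy locus. For $n\ge 1$ let $f^n=f^{n-1}\circ f$ be the $n$-th iterate as a meromorphic map (common factors of the components being removed), and for an analytic set $A$ put $f^n(A)=\overline{f^n(A\setminus I(f^n))}$, $f^0(A)=A$. A hypersurface is a nonempty analytic set of pure codimension $1$. A hypersurface $\mathcal H$ is called degree lowering if $f^n(\mathcal H)\subset I(f)$ for some $n\ge 1$; the smallest such $n$ is its height. The map $f$ is algebraically stable if it has no degree lowering hypersurface. Then there are an integer $M\ge 0$ and degree lowering hypersurfaces $\mathcal H_1,\dots,\mathcal H_M$ with heights $n_1,\dots,n_M$, where every irreducible component of $\mathcal H_j$ also has height $n_j$, such that: (i) the numbers $n_1,\dots,n_M$ are pairwise different; (ii) $\operatorname{codim} f^m(\mathcal H_j)>1$ for $1\le m\le n_j$ and $1\le j\le M$; (iii) for every irreducible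 degree lowering hypersurface $\mathcal H$ of $f$, with height $h$, there are integers $0\le n<h$ and $1\le j\le M$ such that $f^n(\mathcal H)$ is a hypersurface and $f^n(\mathcal H)\subset\mathcal H_j$. The integer $M$ is unique, and the hypersurfaces $\mathcal H_j$ with their heights $n_j$ are unique up to a permutation of the indices. Moreover, $f$ is algebraically stable if and only if $M=0$. -/

import Mathlib

open MvPolynomial

noncomputable section

/-! ### Projective space with the Zariski topology -/

/-- Complex projective space `P^k`. -/
def ProjSpace (k : ℕ) : Type := Projectivization ℂ (Fin (k + 1) → ℂ)

namespace ProjSpace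

/-- The point `[v]` of `P^k` with homogeneous coordinates `v ≠ 0`. -/
def mk {k : ℕ} (v : Fin (k + 1) → ℂ) (hv : v ≠ 0) : ProjSpace k := Projectivization.mk ℂ v hv

/-- A vector of homogeneous coordinates of the point `x`. -/
def coords {k : ℕ} (x : ProjSpace k) : Fin (k + 1) → ℂ := Projectivization.rep x

theorem coords_ne_zero {k : ℕ} (x : ProjSpace k) : x.coords ≠ 0 := Projectivization.rep_nonzero x

theorem mk_coords {k : ℕ} (x : ProjSpace k) : mk x.coords x.coords_ne_zero = x :=
  Projectivization.mk_rep x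

/-- The common zero set in `P^k` of a set of polynomials. It is used only for sets of homogeneous
polynomials, for which it does not depend on the choice of homogeneous coordinates. -/
def zeroLocus {k : ℕ} (S : Set (MvPolynomial (Fin (k + 1)) ℂ)) : Set (ProjSpace k) :=
  {x | ∀ p ∈ S, eval x.coords p = 0}

/-- The algebraic subsets of `P^k` (equivalently, by Chow's theorem, its analytic subsets): the
common zero sets of homogeneous polynomials. -/
def IsAlgebraic {k : ℕ} (A : Set (ProjSpace k)) : Prop :=
  ∃ S : Set (MvPolynomial (Fin (k + 1)) ℂ), (∀ p ∈ S, ∃ d, p.IsHomogeneous d) ∧ A = zeroLocus S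

/-- The Zariski topology: the closed sets are the algebraic (that is, the analytic) subsets. -/
instance (k : ℕ) : TopologicalSpace (ProjSpace k) :=
  TopologicalSpace.ofClosed {A | IsAlgebraic A}
    ⟨{1}, by simpa using ⟨0, isHomogeneous_one _ _⟩, by
      ext x; simp [zeroLocus]⟩
    (by
      intro 𝒜 h𝒜
      choose S hS using fun A : 𝒜 => h𝒜 A.2
      refine ⟨⋃ A, S A, ?_, ?_⟩
      · intro p hp
        obtain ⟨A, hp⟩ := Set.mem_iUnion.1 hp
        exact (hS A).1 p hp
      · ext x
        constructor
        · intro h p hp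
          obtain ⟨A, hp⟩ := Set.mem_iUnion.1 hp
          have := h A.1 A.2
          rw [(hS A).2] at this
          exact this p hp
        · intro h A hA
          have := (hS ⟨A, hA⟩).2
          simp only at this
          rw [this]
          exact fun p hp => h p (Set.mem_iUnion.2 ⟨⟨A, hA⟩, hp⟩))
    (by
      rintro _ ⟨S, hS, rfl⟩ _ ⟨T, hT, rfl⟩
      refine ⟨{r | ∃ p ∈ S, ∃ q ∈ T, r = p * q}, ?_, ?_⟩
      · rintro _ ⟨p, hp, q, hq, rfl⟩
        obtain ⟨a, ha⟩ := hS p hp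
        obtain ⟨b, hb⟩ := hT q hq
        exact ⟨a + b, ha.mul hb⟩
      · ext x
        constructor
        · rintro (h | h) _ ⟨p, hp, q, hq, rfl⟩
          · simp [h p hp]
          · simp [h q hq]
        · intro h
          by_contra hx
          simp only [Set.mem_union, zeroLocus, Set.mem_ofPred_eq, not_or, not_forall] at hx
          obtain ⟨⟨p, hp, hp'⟩, ⟨q, hq, hq'⟩⟩ := hx
          have := h (p * q) ⟨p, hp, q, hq, rfl⟩
          simp_all)

theorem isClosed_iff {k : ℕ} (A : Set (ProjSpace k)) : IsClosed A ↔ IsAlgebraic A := by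
  rw [← isOpen_compl_iff]
  change Aᶜᶜ ∈ {A | IsAlgebraic A} ↔ _
  simp

/-- The codimension of a closed subset `A` of `P^k`: the infimum over the irreducible closed
`Z ⊆ A` of the supremum of the lengths of the chains `Z = Z₀ ⊊ Z₁ ⊊ ⋯ ⊊ Zₙ` of irreducible closed
subsets of `P^k`. The codimension of the empty set is `⊤`. -/
def codim {k : ℕ} (A : Set (ProjSpace k)) : ℕ∞ :=
  ⨅ Z : TopologicalSpace.IrreducibleCloseds (ProjSpace k), ⨅ _ : (Z : Set (ProjSpace k)) ⊆ A,
    Order.coheight Z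

/-- `Z` is an irreducible component of `A`, i.e. a maximal irreducible subset of `A`. -/
def IsComponent {k : ℕ} (Z A : Set (ProjSpace k)) : Prop :=
  Maximal (fun Y : Set (ProjSpace k) => IsIrreducible Y ∧ Y ⊆ A) Z

/-- A hypersurface: a nonempty closed subset of pure codimension `1`. -/
def IsHypersurface {k : ℕ} (H : Set (ProjSpace k)) : Prop :=
  IsClosed H ∧ H.Nonempty ∧ ∀ Z, IsComponent Z H → codim Z = 1

end ProjSpace

/-! ### Dominating meromorphic self-maps -/

/-- The Jacobian matrix of a polynomial self-map of `ℂ^{k+1}`. -/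
def polyJacobian {k : ℕ} (F : Fin (k + 1) → MvPolynomial (Fin (k + 1)) ℂ) :
    Matrix (Fin (k + 1)) (Fin (k + 1)) (MvPolynomial (Fin (k + 1)) ℂ) :=
  Matrix.of fun i j => pderiv j (F i)

/-- A dominating meromorphic self-map `f = [F_0 : ⋯ : F_k]` of `P^k`, given by a lifting
`F = (F_0, …, F_k)`: homogeneous polynomials of the same degree without nontrivial common factor.
That `f` has generically maximal rank `k` is expressed by the Jacobian determinant of the lifting:
where `F z ≠ 0`, the derivative of `F` maps the line `ℂ z` onto the line `ℂ F(z)`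
by Euler's identity (if the degree is positive), hence it is invertible at `z` if and only if
the derivative of `f` at `[z]` is; in degree zero `f` is constant and the determinant vanishes. -/
structure DominatingMap (k : ℕ) where
  /-- the algebraic degree -/
  deg : ℕ
  /-- the lifting -/
  F : Fin (k + 1) → MvPolynomial (Fin (k + 1)) ℂ
  homogeneous : ∀ i, (F i).IsHomogeneous deg
  coprime : ∀ q : MvPolynomial (Fin (k + 1)) ℂ, (∀ i, q ∣ F i) → IsUnit q
  dominating : (polyJacobian F).det ≠ 0

namespace DominatingMap

/-! #### Auxiliary facts for the composition -/

theorem pderiv_bind₁' {σ τ : Type*} [Fintype σ] (f : σ → MvPolynomial τ ℂ) (j : τ)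
    (p : MvPolynomial σ ℂ) :
    pderiv j (bind₁ f p) = ∑ i, bind₁ f (pderiv i p) * pderiv j (f i) := by
  classical
  induction p using MvPolynomial.induction_on with
  | C a => simp
  | add p q hp hq => simp [hp, hq, add_mul, Finset.sum_add_distrib]
  | mul_X p i hp =>
    have h1 : ∀ x, bind₁ f (pderiv x (p * X i)) * pderiv j (f x) =
        bind₁ f (pderiv x p) * pderiv j (f x) * f i +
          (if x = i then bind₁ f p * pderiv j (f i) else 0) := by
      intro x
      by_cases hx : x = i
      · subst hx
        rw [pderiv_mul, pderiv_X_self, map_add, map_mul, map_mul, bind₁_X_right, map_one, if_pos rfl]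
        ring
      · rw [pderiv_mul, pderiv_X_of_ne (Ne.symm hx), map_add, map_mul, map_mul, bind₁_X_right,
          map_zero, if_neg hx]
        ring
    rw [Finset.sum_congr rfl fun x _ => h1 x, Finset.sum_add_distrib, ← Finset.sum_mul, ← hp,
      Finset.sum_ite_eq' Finset.univ i, if_pos (Finset.mem_univ _), map_mul, bind₁_X_right,
      pderiv_mul]

theorem bind₁_ne_zero {k : ℕ} {f : Fin (k + 1) → MvPolynomial (Fin (k + 1)) ℂ}
    (hf : (polyJacobian f).det ≠ 0) {p : MvPolynomial (Fin (k + 1)) ℂ} (hp : p ≠ 0) :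
    bind₁ f p ≠ 0 := by
  classical
  induction hn : p.totalDegree using Nat.strong_induction_on generalizing p with
  | _ n ih =>
  intro h0
  have h1 : (fun i => bind₁ f (pderiv i p)) = 0 := by
    refine Matrix.eq_zero_of_vecMul_eq_zero hf ?_
    funext j
    have := pderiv_bind₁' f j p
    rw [h0, map_zero] at this
    simpa [Matrix.vecMul, dotProduct, polyJacobian] using this.symm
  have h2 : ∀ i, pderiv i p = 0 := by
    intro i
    by_contra hi
    refine ih _ ?_ hi rfl (congrFun h1 i)
    subst hn
    have key : ∀ m ∈ (pderiv i p).support, (m.sum fun _ e => e) + 1 ≤ p.totalDegree := by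
      intro m hm
      rw [mem_support_iff, coeff_pderiv] at hm
      have := le_totalDegree (mem_support_iff.2 (left_ne_zero_of_mul hm))
      rwa [Finsupp.sum_add_index' (fun _ => rfl) (fun _ _ _ => rfl),
        Finsupp.sum_single_index rfl] at this
    obtain ⟨m, hm⟩ := support_nonempty.2 hi
    refine (Finset.sup_lt_iff (lt_of_lt_of_le (Nat.succ_pos _) (key m hm))).2 ?_
    exact fun m hm => key m hm
  have h3 : p = C (coeff 0 p) := by
    ext m
    rw [coeff_C]
    split_ifs with hm
    · rw [hm]
    · obtain ⟨i, hi⟩ : ∃ i, m i ≠ 0 := by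
        by_contra! h
        exact hm (Finsupp.ext fun i => (h i).symm)
      have hm' : m - Finsupp.single i 1 + Finsupp.single i 1 = m := by
        refine tsub_add_cancel_of_le ?_
        rw [Finsupp.single_le_iff]
        exact Nat.one_le_iff_ne_zero.2 hi
      have := coeff_pderiv (i := i) p (m - Finsupp.single i 1)
      rw [h2 i, coeff_zero, hm'] at this
      rcases mul_eq_zero.1 this.symm with h | h
      · exact h
      · exact absurd h (Nat.cast_add_one_ne_zero _)
  rw [h3] at h0 hp
  rw [bind₁_C_right] at h0
  exact hp h0

/-- The homogeneous components of `p`, as coefficients of a polynomial in an extra variable. -/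
def grade {σ : Type*} : MvPolynomial σ ℂ →ₐ[ℂ] Polynomial (MvPolynomial σ ℂ) :=
  aeval fun i => Polynomial.C (X i) * Polynomial.X

theorem grade_monomial {σ : Type*} (m : σ →₀ ℕ) (a : ℂ) :
    grade (monomial m a) = Polynomial.monomial m.degree (monomial m a) := by
  rw [grade, aeval_monomial, ← Polynomial.C_mul_X_pow_eq_monomial, monomial_eq (s := m)]
  simp only [Finsupp.prod, mul_pow, Finset.prod_mul_distrib, Finset.prod_pow_eq_pow_sum,
    ← map_pow, ← map_prod, Polynomial.C_mul, Finsupp.degree_apply]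
  rw [← mul_assoc]
  rfl

theorem coeff_grade {σ : Type*} (p : MvPolynomial σ ℂ) (n : ℕ) :
    (grade p).coeff n = homogeneousComponent n p := by
  induction p using MvPolynomial.induction_on' with
  | monomial m a =>
    rw [grade_monomial, Polynomial.coeff_monomial,
      homogeneousComponent_of_mem (n := m.degree)
        ((mem_homogeneousSubmodule _ _).2 (isHomogeneous_monomial a rfl))]
    simp [eq_comm]
  | add p q hp hq => simp [hp, hq]

theorem grade_ne_zero {σ : Type*} {p : MvPolynomial σ ℂ} (hp : p ≠ 0) : grade p ≠ 0 := by
  intro h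
  apply hp
  rw [← sum_homogeneousComponent p]
  exact Finset.sum_eq_zero fun n _ => by rw [← coeff_grade, h, Polynomial.coeff_zero]

theorem isHomogeneous_of_grade {σ : Type*} {p : MvPolynomial σ ℂ} {n : ℕ}
    (h : ∀ m, m ≠ n → (grade p).coeff m = 0) : p.IsHomogeneous n := by
  have : p = homogeneousComponent n p := by
    conv_lhs => rw [← sum_homogeneousComponent p]
    by_cases hn : n < p.totalDegree + 1
    · rw [Finset.sum_eq_single n]
      · intro m _ hm
        rw [← coeff_grade, h m hm]
      · intro h'
        exact absurd (Finset.mem_range.2 hn) h'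
    · rw [homogeneousComponent_eq_zero n p (by omega)]
      exact Finset.sum_eq_zero fun m hm => by
        rw [← coeff_grade, h m]
        have := Finset.mem_range.1 hm
        omega
  rw [this]
  exact homogeneousComponent_isHomogeneous n p

theorem isHomogeneous_of_mul {σ : Type*} {p q : MvPolynomial σ ℂ} {n : ℕ} (hpq : p * q ≠ 0)
    (h : (p * q).IsHomogeneous n) :
    ∃ a b, p.IsHomogeneous a ∧ q.IsHomogeneous b ∧ a + b = n := by
  have hp := grade_ne_zero (left_ne_zero_of_mul hpq)
  have hq := grade_ne_zero (right_ne_zero_of_mul hpq)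
  have hg : grade (p * q) = Polynomial.monomial n (p * q) := by
    ext1 m
    rw [coeff_grade, homogeneousComponent_of_mem ((mem_homogeneousSubmodule _ _).2 h),
      Polynomial.coeff_monomial]
    simp [eq_comm]
  have h1 : (grade p).natDegree + (grade q).natDegree = n := by
    rw [← Polynomial.natDegree_mul hp hq, ← map_mul, hg, Polynomial.natDegree_monomial_eq _ hpq]
  have h2 : (grade p).natTrailingDegree + (grade q).natTrailingDegree = n := by
    rw [← Polynomial.natTrailingDegree_mul hp hq, ← map_mul, hg,
      Polynomial.natTrailingDegree_monomial hpq]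
  have h3 := Polynomial.natTrailingDegree_le_natDegree (grade p)
  have h4 := Polynomial.natTrailingDegree_le_natDegree (grade q)
  have aux : ∀ r : Polynomial (MvPolynomial σ ℂ), r.natTrailingDegree = r.natDegree →
      ∀ m, m ≠ r.natDegree → r.coeff m = 0 := by
    intro r hr m hm
    rcases lt_or_gt_of_ne hm with hm | hm
    · exact Polynomial.coeff_eq_zero_of_lt_natTrailingDegree (hr ▸ hm)
    · exact Polynomial.coeff_eq_zero_of_natDegree_lt hm
  exact ⟨_, _, isHomogeneous_of_grade (aux _ (by omega)), isHomogeneous_of_grade (aux _ (by omega)),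
    h1⟩

/-- Removing a common factor from a homogeneous tuple preserves nonvanishing of the Jacobian. -/
theorem jacobian_of_mul {k : ℕ} (q : MvPolynomial (Fin (k + 1)) ℂ)
    {G : Fin (k + 1) → MvPolynomial (Fin (k + 1)) ℂ} {e : ℕ} (hG : ∀ i, (G i).IsHomogeneous e)
    (hk : k ≠ 0)
    (h : (polyJacobian fun i => q * G i).det ≠ 0) : (polyJacobian G).det ≠ 0 := by
  have hJ : polyJacobian (fun i => q * G i) =
      q • polyJacobian G + Matrix.vecMulVec G (fun j => pderiv j q) := by
    ext1 i j
    simp [polyJacobian, Matrix.vecMulVec]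
  rw [hJ] at h
  by_cases he : e = 0
  · subst he
    have h0 : polyJacobian G = 0 := by
      ext1 i j
      have := (totalDegree_zero_iff_isHomogeneous _).2 (hG i)
      rw [totalDegree_eq_zero_iff_eq_C] at this
      simp only [polyJacobian, Matrix.of_apply, Matrix.zero_apply]
      rw [this, pderiv_C]
    have : Nontrivial (Fin (k + 1)) := Fin.nontrivial_iff_two_le.2 (by omega)
    rw [h0, smul_zero, zero_add, Matrix.det_vecMulVec] at h
    exact absurd rfl h
  · have hE : G = (polyJacobian G).mulVec fun j => C ((e : ℂ)⁻¹) * X j := by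
      funext i
      have := (hG i).sum_X_mul_pderiv
      simp only [Matrix.mulVec, dotProduct, polyJacobian, Matrix.of_apply]
      calc G i = C ((e : ℂ)⁻¹) * (e • G i) := by
            rw [nsmul_eq_mul, ← mul_assoc, ← map_natCast C, ← C_mul,
              inv_mul_cancel₀ (Nat.cast_ne_zero.2 he), C_1, one_mul]
        _ = _ := by
            rw [← this, Finset.mul_sum]
            exact Finset.sum_congr rfl fun j _ => by ring
    have : q • polyJacobian G + Matrix.vecMulVec G (fun j => pderiv j q) = polyJacobian G *
        (q • (1 : Matrix (Fin (k + 1)) (Fin (k + 1)) (MvPolynomial (Fin (k + 1)) ℂ)) +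
          Matrix.vecMulVec (fun j => C ((e : ℂ)⁻¹) * X j) (fun j => pderiv j q)) := by
      rw [mul_add, Matrix.mul_smul, mul_one, Matrix.mul_vecMulVec, ← hE]
    rw [this, Matrix.det_mul] at h
    exact left_ne_zero_of_mul h

theorem k_ne_zero {k : ℕ} (f : DominatingMap k) : k ≠ 0 := by
  rintro rfl
  have hu : IsUnit (f.F 0) := f.coprime _ fun i => by rw [Fin.fin_one_eq_zero i]
  have hC := MvPolynomial.isUnit_iff_eq_C_of_isReduced.1 hu
  obtain ⟨c, -, hc⟩ := hC
  apply f.dominating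
  rw [Matrix.det_fin_one]
  simp [polyJacobian, hc]

theorem exists_comp {k : ℕ} (g f : DominatingMap k) :
    ∃ h : DominatingMap k, ∃ q : MvPolynomial (Fin (k + 1)) ℂ, q ≠ 0 ∧
      ∀ i, bind₁ f.F (g.F i) = q * h.F i := by
  classical
  let _ : NormalizedGCDMonoid (MvPolynomial (Fin (k + 1)) ℂ) :=
    Classical.arbitrary _
  set P : Fin (k + 1) → MvPolynomial (Fin (k + 1)) ℂ := fun i => bind₁ f.F (g.F i) with hP
  obtain ⟨G, hG, hG1⟩ := Finset.univ.extract_gcd P ⟨0, Finset.mem_univ _⟩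
  set q := Finset.univ.gcd P with hq
  have hPh : ∀ i, (P i).IsHomogeneous (f.deg * g.deg) := fun i =>
    (g.homogeneous i).aeval _ f.homogeneous
  have hjac : (polyJacobian P).det ≠ 0 := by
    have : polyJacobian P = (bind₁ f.F).mapMatrix (polyJacobian g.F) * polyJacobian f.F := by
      ext1 i j
      simp only [polyJacobian, Matrix.of_apply, Matrix.mul_apply, hP, pderiv_bind₁']
      rfl
    rw [this, Matrix.det_mul, ← AlgHom.map_det]
    exact mul_ne_zero (bind₁_ne_zero f.dominating g.dominating) f.dominating
  obtain ⟨i₀, hi₀⟩ : ∃ i, P i ≠ 0 := by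
    by_contra! h
    apply hjac
    refine Matrix.det_eq_zero_of_row_eq_zero 0 fun j => ?_
    simp [polyJacobian, h 0]
  have hGP : ∀ i, P i = q * G i := fun i => hG i (Finset.mem_univ _)
  have hq0 : q ≠ 0 := by
    intro h0
    exact hi₀ (by rw [hGP, h0, zero_mul])
  obtain ⟨a, b, ha, -, -⟩ := isHomogeneous_of_mul (hGP i₀ ▸ hi₀) (hGP i₀ ▸ hPh i₀)
  have hGh : ∀ i, (G i).IsHomogeneous (f.deg * g.deg - a) := by
    intro i
    by_cases hi : G i = 0
    · rw [hi]
      exact isHomogeneous_zero _ _ _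
    · have hne : q * G i ≠ 0 := mul_ne_zero hq0 hi
      obtain ⟨a', b', ha', hb', hab⟩ := isHomogeneous_of_mul hne (hGP i ▸ hPh i)
      have := ha.inj_right ha' hq0
      rw [← hab, this, Nat.add_sub_cancel_left]
      exact hb'
  have hGc : ∀ r : MvPolynomial (Fin (k + 1)) ℂ, (∀ i, r ∣ G i) → IsUnit r := fun r hr =>
    isUnit_of_dvd_one (hG1 ▸ Finset.dvd_gcd fun i _ => hr i)
  refine ⟨⟨_, G, hGh, hGc, ?_⟩, q, hq0, hGP⟩
  refine jacobian_of_mul q hGh f.k_ne_zero ?_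
  rwa [← (funext hGP : P = fun i => q * G i)]

/-- The composition `g ∘ f`: its lifting is `G ∘ F` divided by the greatest common divisor of the
components of `G ∘ F` (it is determined up to a nonzero constant). -/
def comp {k : ℕ} (g f : DominatingMap k) : DominatingMap k := (exists_comp g f).choose

theorem comp_spec {k : ℕ} (g f : DominatingMap k) : ∃ q : MvPolynomial (Fin (k + 1)) ℂ, q ≠ 0 ∧
    ∀ i, bind₁ f.F (g.F i) = q * (g.comp f).F i := (exists_comp g f).choose_spec

/-- `f.iterateSucc n` is the iterate `f^{n+1}`: `f^1 = f` and `f^{n+1} = f^n ∘ f`. -/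
def iterateSucc {k : ℕ} (f : DominatingMap k) : ℕ → DominatingMap k
  | 0 => f
  | n + 1 => (iterateSucc f n).comp f

/-! #### Indeterminacy, images, stability -/

/-- The indeterminacy locus of `f`. -/
def indet {k : ℕ} (f : DominatingMap k) : Set (ProjSpace k) := ProjSpace.zeroLocus (Set.range f.F)

/-- The value of a lifting of `f` at homogeneous coordinates of the point `x`. -/
def value {k : ℕ} (f : DominatingMap k) (x : ProjSpace k) : Fin (k + 1) → ℂ :=
  fun i => eval x.coords (f.F i)

theorem value_ne_zero {k : ℕ} (f : DominatingMap k) {x : ProjSpace k} (hx : x ∉ f.indet) :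
    f.value x ≠ 0 := by
  intro h
  apply hx
  rintro _ ⟨i, rfl⟩
  exact congrFun h i

/-- The map `f : P^k \ I(f) → P^k`. -/
def apply {k : ℕ} (f : DominatingMap k) (x : ProjSpace k) (hx : x ∉ f.indet) : ProjSpace k :=
  ProjSpace.mk (f.value x) (f.value_ne_zero hx)

/-- The image `f(A)`: the closure of `f(A \ I(f))`. -/
def image {k : ℕ} (f : DominatingMap k) (A : Set (ProjSpace k)) : Set (ProjSpace k) :=
  closure {y | ∃ x, ∃ hx : x ∉ f.indet, x ∈ A ∧ f.apply x hx = y}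

/-- The image `f^n(A)` of `A` under the meromorphic map `f^n`, with `f^0(A) = A`. -/
def iterImage {k : ℕ} (f : DominatingMap k) : ℕ → Set (ProjSpace k) → Set (ProjSpace k)
  | 0, A => A
  | n + 1, A => (f.iterateSucc n).image A

/-- `n` is the smallest integer `n ≥ 1` with `f^n(A) ⊆ I(f)`. -/
def HasHeight {k : ℕ} (f : DominatingMap k) (A : Set (ProjSpace k)) (n : ℕ) : Prop :=
  IsLeast {m | 1 ≤ m ∧ f.iterImage m A ⊆ f.indet} n

/-- A degree lowering hypersurface `H` of `f` with height `n`. -/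
def IsDegreeLowering {k : ℕ} (f : DominatingMap k) (H : Set (ProjSpace k)) (n : ℕ) : Prop :=
  ProjSpace.IsHypersurface H ∧ f.HasHeight H n

/-- `f` is algebraically stable: no hypersurface is sent by some iterate of `f` into `I(f)`. -/
def IsAlgebraicallyStable {k : ℕ} (f : DominatingMap k) : Prop :=
  ¬ ∃ (H : Set (ProjSpace k)) (N : ℕ),
    ProjSpace.IsHypersurface H ∧ 1 ≤ N ∧ f.iterImage N H ⊆ f.indet

/-- `H_1, …, H_M` are degree lowering hypersurfaces with heights `n_1, …, n_M`, all irreducible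
components of `H_j` having the same height `n_j`, such that
* the heights `n_j` are pairwise different;
* `codim f^m(H_j) > 1` for `1 ≤ m ≤ n_j`;
* every irreducible degree lowering hypersurface `H` has, before the time at which it is sent into
  `I(f)` (its height `h`), an image `f^n(H)` that is a hypersurface contained in some `H_j`. -/
structure IsPrimitiveFamily {k : ℕ} (f : DominatingMap k) (M : ℕ) (H : Fin M → Set (ProjSpace k))
    (n : Fin M → ℕ) : Prop where
  degreeLowering : ∀ j, f.IsDegreeLowering (H j) (n j)
  component : ∀ j Z, ProjSpace.IsComponent Z (H j) → f.HasHeight Z (n j)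
  injective : Function.Injective n
  codim : ∀ j m, 1 ≤ m → m ≤ n j → 1 < ProjSpace.codim (f.iterImage m (H j))
  lands : ∀ (A : Set (ProjSpace k)) (h : ℕ), IsIrreducible A → f.IsDegreeLowering A h →
    ∃ m < h, ∃ j, ProjSpace.IsHypersurface (f.iterImage m A) ∧ f.iterImage m A ⊆ H j

end DominatingMap

end

/-! Call an irreducible degree lowering hypersurface of height `n` primitive if its images under `f,
..., f^n` all have codimension at least two (`IsPrimitive`). The `H_j` are the unions of the
primitive hypersurfaces of equal height.

Finiteness: `f` itself contracts a primitive hypersurface `V(p)`, so `p` divides the Jacobian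
determinant of the lifting (`dvd_det_of_one_lt_codim`), which has finitely many prime factors. The
algebraic core is `eq_span_singleton_of_not_dvd_det`: if `p` does not divide the determinant, the
ideal of the image of `V(p)`, when nonzero, is principal, so the image has codimension at most one.

Existence: along the orbit of an irreducible degree lowering `A`, no image before the height lies in
`I(f)`, and none is the whole space, since by dominance it would stay the whole space. The last
image of codimension one is therefore primitive (`exists_isPrimitive_iterImage`).

Uniqueness: the components of the members of any admissible family are exactly the primitive
hypersurfaces, and distinct heights determine the grouping.

Orbits are handled through ideals. As long as the unreduced lifting of `f^n` does not vanish
identically on an irreducible `A`, the ideal of `f^n(A)` is the contraction of the ideal of `A`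
(`vanishing_iterImage`). Images of irreducible sets are then irreducible and compose as expected
until the orbit enters `I(f)`. -/

noncomputable section

/-! ### Polynomial algebra -/

namespace Polynomial

/-- Two elements of `R[X]` without common factor have a common eliminant in `R`. -/
theorem exists_C_mem_span_pair {R : Type*} [CommRing R] [IsDomain R] [UniqueFactorizationMonoid R]
    {g h : Polynomial R} (hg : Irreducible g) (hd : g.natDegree ≠ 0) (hgh : ¬ g ∣ h) :
    ∃ r : R, r ≠ 0 ∧ C r ∈ Ideal.span {g, h} := by
  classical
  let _ : NormalizedGCDMonoid R := Classical.arbitrary _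
  let K := FractionRing R
  have hprim : g.IsPrimitive := hg.isPrimitive hd
  -- By Gauss's lemma, irreducibility of `g` and `g ∤ h` persist over the fraction field, where they
  -- give a Bézout identity. Clearing its denominators `a` and `b` produces the eliminant `a * b`.
  have hirr : Irreducible (g.map (algebraMap R K)) :=
    hprim.irreducible_iff_irreducible_map_fraction_map.1 hg
  have hnd : ¬ g.map (algebraMap R K) ∣ h.map (algebraMap R K) :=
    fun hdvd => hgh (hprim.dvd_of_fraction_map_dvd_fraction_map (K := K) hdvd)
  obtain ⟨u, v, huv⟩ := (hirr.coprime_iff_not_dvd).2 hnd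
  obtain ⟨a, ham, ha⟩ := IsLocalization.integerNormalization_spec (nonZeroDivisors R) u
  obtain ⟨b, hbm, hb⟩ := IsLocalization.integerNormalization_spec (nonZeroDivisors R) v
  set u' := IsLocalization.integerNormalization (nonZeroDivisors R) u
  set v' := IsLocalization.integerNormalization (nonZeroDivisors R) v
  refine ⟨a * b, mul_ne_zero (nonZeroDivisors.ne_zero ham) (nonZeroDivisors.ne_zero hbm), ?_⟩
  have key : C (a * b) = (C b * u') * g + (C a * v') * h := by
    apply Polynomial.map_injective (algebraMap R K) (IsFractionRing.injective R K)
    simp only [Polynomial.map_add, Polynomial.map_mul, Polynomial.map_C, ha, hb, map_mul,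
      Algebra.smul_def, Polynomial.algebraMap_apply]
    linear_combination -(C ((algebraMap R K) a) * C ((algebraMap R K) b)) * huv
  rw [key]
  exact Ideal.add_mem _ (Ideal.mul_mem_left _ _ (Ideal.subset_span (by simp)))
    (Ideal.mul_mem_left _ _ (Ideal.subset_span (by simp)))

end Polynomial

namespace MvPolynomial

theorem totalDegree_pderiv_lt {σ : Type*} {p : MvPolynomial σ ℂ} {i : σ} (hi : pderiv i p ≠ 0) :
    (pderiv i p).totalDegree < p.totalDegree := by
  have key : ∀ m ∈ (pderiv i p).support, (m.sum fun _ e => e) + 1 ≤ p.totalDegree := by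
    intro m hm
    rw [mem_support_iff, coeff_pderiv] at hm
    have := le_totalDegree (mem_support_iff.2 (left_ne_zero_of_mul hm))
    rwa [Finsupp.sum_add_index' (fun _ => rfl) (fun _ _ _ => rfl),
      Finsupp.sum_single_index rfl] at this
  obtain ⟨m, hm⟩ := support_nonempty.2 hi
  exact (Finset.sup_lt_iff (lt_of_lt_of_le (Nat.succ_pos _) (key m hm))).2 fun m hm => key m hm

/-- Characteristic zero: the coefficient at `m` reappears in `pderiv i p` multiplied by the nonzero
number `m i`. -/
theorem eq_C_of_pderiv_eq_zero {σ : Type*} {p : MvPolynomial σ ℂ} (h : ∀ i, pderiv i p = 0) :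
    p = C (coeff 0 p) := by
  classical
  ext m
  rw [coeff_C]
  split_ifs with hm
  · rw [hm]
  · obtain ⟨i, hi⟩ : ∃ i, m i ≠ 0 := by
      by_contra! h
      exact hm (Finsupp.ext fun i => (h i).symm)
    have hm' : m - Finsupp.single i 1 + Finsupp.single i 1 = m := by
      refine tsub_add_cancel_of_le ?_
      rw [Finsupp.single_le_iff]
      exact Nat.one_le_iff_ne_zero.2 hi
    have := coeff_pderiv (i := i) p (m - Finsupp.single i 1)
    rw [h i, coeff_zero, hm'] at this
    exact (mul_eq_zero.1 this.symm).resolve_right (Nat.cast_add_one_ne_zero _)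

theorem pderiv_comm {σ : Type*} (i j : σ) (p : MvPolynomial σ ℂ) :
    pderiv i (pderiv j p) = pderiv j (pderiv i p) := by
  classical
  by_cases hij : i = j
  · rw [hij]
  · ext m
    simp only [coeff_pderiv, Finsupp.add_apply, Finsupp.single_eq_of_ne hij,
      Finsupp.single_eq_of_ne (Ne.symm hij), add_zero]
    rw [add_right_comm]
    ring

/-- Elimination of a variable that occurs in an irreducible polynomial. -/
theorem exists_mem_span_pair_pderiv_eq_zero {σ : Type*} {g h : MvPolynomial σ ℂ} (i : σ)
    (hg : Irreducible g) (hi : pderiv i g ≠ 0) (hgh : ¬ g ∣ h) :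
    ∃ w ∈ Ideal.span {g, h}, w ≠ 0 ∧ pderiv i w = 0 := by
  classical
  -- Regard everything as a polynomial in `X i` over the ring in the other variables. Then `g` has
  -- positive degree because `pderiv i g ≠ 0`, and a constant eliminant is free of `X i`.
  let e : MvPolynomial σ ℂ ≃ₐ[ℂ] Polynomial (MvPolynomial {j // j ≠ i} ℂ) :=
    (renameEquiv ℂ (Equiv.optionSubtypeNe i).symm).trans (optionEquivLeft ℂ _)
  have hC : ∀ r : MvPolynomial {j // j ≠ i} ℂ, pderiv i (e.symm (Polynomial.C r)) = 0 := by
    intro r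
    have h1 : e.symm (Polynomial.C r) = rename (↑) r := by
      rw [AlgEquiv.symm_apply_eq]
      induction r using MvPolynomial.induction_on with
      | C a => simp [e]
      | add p q hp hq => simp [hp, hq]
      | mul_X p j hp =>
        have hj : e (X j) = Polynomial.C (X j) := by
          simp only [e, AlgEquiv.trans_apply, renameEquiv_apply, rename_X]
          rw [Equiv.optionSubtypeNe_symm_of_ne j.2, optionEquivLeft_X_some]
        rw [map_mul, map_mul, hp, map_mul, rename_X, hj]
    rw [h1]
    refine pderiv_eq_zero_of_notMem_vars fun hmem => ?_
    obtain ⟨j, -, hj⟩ := Finset.mem_image.1 (vars_rename _ r hmem)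
    exact j.2 hj
  have hd : (e g).natDegree ≠ 0 := by
    intro h0
    obtain ⟨r, hr⟩ := Polynomial.natDegree_eq_zero.1 h0
    apply hi
    rw [← hC r, hr, AlgEquiv.symm_apply_apply]
  obtain ⟨r, hr, hmem⟩ := Polynomial.exists_C_mem_span_pair
    ((MulEquiv.irreducible_iff e).2 hg) hd (h := e h) (fun hdvd => hgh ((map_dvd_iff e).1 hdvd))
  refine ⟨e.symm (Polynomial.C r), ?_, by simpa using hr, hC r⟩
  rw [Ideal.mem_span_pair] at hmem ⊢
  obtain ⟨a, b, hab⟩ := hmem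
  exact ⟨e.symm a, e.symm b, by rw [← hab]; simp⟩

/-- Where the Jacobian matrix of `F` is generically invertible along `V(p)`, the image of `V(p)`
has codimension at most one: the polynomials vanishing on it form a principal ideal. -/
theorem eq_span_singleton_of_not_dvd_det {k : ℕ}
    {F : Fin (k + 1) → MvPolynomial (Fin (k + 1)) ℂ} {p : MvPolynomial (Fin (k + 1)) ℂ}
    (hp : Prime p) (hJ : ¬ p ∣ (polyJacobian F).det)
    {Q : Ideal (MvPolynomial (Fin (k + 1)) ℂ)} (hQ : ∀ g, g ∈ Q ↔ p ∣ bind₁ F g) (hQ0 : Q ≠ ⊥) :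
    ∃ g, Irreducible g ∧ Q = Ideal.span {g} := by
  classical
  have hQ1 : ∀ u, IsUnit u → u ∉ Q := fun u hu h =>
    hp.not_isUnit (isUnit_of_dvd_unit ((hQ u).1 h) (hu.map _))
  have hconst : ∀ g : MvPolynomial (Fin (k + 1)) ℂ, g ∈ Q → g ≠ 0 → g ≠ C (coeff 0 g) := by
    intro g hg h0 h
    rw [h] at hg h0
    exact hQ1 _ ((IsUnit.mk0 _ fun hc => h0 (by rw [hc, C_0])).map C) hg
  -- Modulo `p` the Jacobian matrix has trivial left kernel: multiply by its adjugate and cancel the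
  -- determinant.
  have hcancel : ∀ c : Fin (k + 1) → MvPolynomial (Fin (k + 1)) ℂ,
      (∀ l, p ∣ ∑ s, c s * polyJacobian F s l) → ∀ s, p ∣ c s := by
    intro c hc s
    have h1 : Matrix.vecMul (Matrix.vecMul c (polyJacobian F)) (polyJacobian F).adjugate s =
        (polyJacobian F).det * c s := by
      rw [Matrix.vecMul_vecMul, Matrix.mul_adjugate, Matrix.vecMul_smul, Matrix.vecMul_one]
      simp
    refine (hp.dvd_or_dvd (b := c s) ?_).resolve_left hJ
    rw [← h1]
    change p ∣ ∑ l, (∑ t, c t * polyJacobian F t l) * _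
    exact Finset.dvd_sum fun l _ => Dvd.dvd.mul_right (hc l) _
  have hderiv : ∀ g a, bind₁ F g = p * a → ∀ l,
      ∑ s, bind₁ F (pderiv s g) * polyJacobian F s l = p * pderiv l a + a * pderiv l p := by
    intro g a hga l
    have := DominatingMap.pderiv_bind₁' F l g
    rw [hga, pderiv_mul] at this
    simp only [polyJacobian, Matrix.of_apply, ← this]
    ring
  -- The generator is a nonzero element of least degree. Primality of `p` makes it irreducible, and
  -- its nonzero derivatives, being of lower degree, lie outside `Q`.
  obtain ⟨g, ⟨hgQ, hg0⟩, hgmin⟩ := exists_minimalFor_of_wellFoundedLT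
    (fun g : MvPolynomial (Fin (k + 1)) ℂ => g ∈ Q ∧ g ≠ 0) totalDegree
    (Submodule.exists_mem_ne_zero_of_ne_bot hQ0)
  have hgmin' : ∀ w ∈ Q, w ≠ 0 → g.totalDegree ≤ w.totalDegree := fun w hw hw0 =>
    (le_total _ _).elim id fun h => hgmin ⟨hw, hw0⟩ h
  have hunit : ∀ a b : MvPolynomial (Fin (k + 1)) ℂ, g = a * b → a ∈ Q → IsUnit b := by
    rintro a b rfl ha
    have ha0 := left_ne_zero_of_mul hg0
    have hb0 := right_ne_zero_of_mul hg0
    have := hgmin' a ha ha0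
    rw [totalDegree_mul_of_isDomain ha0 hb0] at this
    have hb : b.totalDegree = 0 := by omega
    rw [totalDegree_eq_zero_iff_eq_C] at hb
    rw [hb] at hb0 ⊢
    exact (IsUnit.mk0 _ fun hc => hb0 (by rw [hc, C_0])).map C
  have hgirr : Irreducible g := by
    refine ⟨fun hu => hQ1 g hu hgQ, fun a b hab => ?_⟩
    have h1 := (hQ g).1 hgQ
    rw [hab, map_mul] at h1
    rcases hp.dvd_or_dvd h1 with h | h
    · exact Or.inr (hunit a b hab ((hQ a).2 h))
    · exact Or.inl (hunit b a (by rw [hab, mul_comm]) ((hQ b).2 h))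
  obtain ⟨i, hi⟩ : ∃ i, pderiv i g ≠ 0 := by
    by_contra! h
    exact hconst g hgQ hg0 (eq_C_of_pderiv_eq_zero h)
  have hiQ : pderiv i g ∉ Q := fun h =>
    absurd (totalDegree_pderiv_lt hi) (not_lt.2 (hgmin' _ h hi))
  refine ⟨g, hgirr, le_antisymm (fun h hhQ => ?_) ((Ideal.span_singleton_le_iff_mem _).2 hgQ)⟩
  rw [Ideal.mem_span_singleton]
  by_contra hgh
  obtain ⟨w₀, hw₀, hw₀0, hw₀i⟩ := exists_mem_span_pair_pderiv_eq_zero i hgirr hi hgh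
  have hle : Ideal.span {g, h} ≤ Q := Ideal.span_le.2 (by rintro x (rfl | rfl) <;> assumption)
  -- If `g ∤ h`, then `Q` contains nonzero elements free of `X i`. For one of least degree, a
  -- nonzero `pderiv j w` is again free of `X i`, hence outside `Q`.
  obtain ⟨w, ⟨hwQ, hw0, hwi⟩, hwmin⟩ := exists_minimalFor_of_wellFoundedLT
    (fun w : MvPolynomial (Fin (k + 1)) ℂ => w ∈ Q ∧ w ≠ 0 ∧ pderiv i w = 0) totalDegree
    ⟨w₀, hle hw₀, hw₀0, hw₀i⟩
  obtain ⟨j, hj⟩ : ∃ j, pderiv j w ≠ 0 := by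
    by_contra! h
    exact hconst w hwQ hw0 (eq_C_of_pderiv_eq_zero h)
  have hjQ : pderiv j w ∉ Q := by
    intro h
    have h2 : pderiv i (pderiv j w) = 0 := by
      rw [pderiv_comm, hwi, map_zero]
    exact absurd (totalDegree_pderiv_lt hj)
      (not_lt.2 ((le_total _ _).elim id fun h' => hwmin ⟨h, hj, h2⟩ h'))
  obtain ⟨a, ha⟩ := (hQ g).1 hgQ
  obtain ⟨b, hb⟩ := (hQ w).1 hwQ
  -- Along `V(p)` both pulled-back differentials are proportional to `dp`, with factors `a` and `b`.
  -- This combination cancels `dp`, so all its entries are divisible by `p`.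
  have h1 := hcancel (fun s => b * bind₁ F (pderiv s g) - a * bind₁ F (pderiv s w)) (fun l => by
    have : ∑ s, (b * bind₁ F (pderiv s g) - a * bind₁ F (pderiv s w)) * polyJacobian F s l =
        b * (p * pderiv l a + a * pderiv l p) - a * (p * pderiv l b + b * pderiv l p) := by
      rw [← hderiv g a ha, ← hderiv w b hb, Finset.mul_sum, Finset.mul_sum,
        ← Finset.sum_sub_distrib]
      exact Finset.sum_congr rfl fun s _ => by ring
    rw [this]
    exact ⟨b * pderiv l a - a * pderiv l b, by ring⟩) i
  rw [hwi, map_zero, mul_zero, sub_zero] at h1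
  -- Since `w` is free of `X i`, the entry `i` yields `p ∣ b`. So the pull-back of `w` is divisible
  -- by `p ^ 2`, its differential vanishes modulo `p`, and `pderiv j w` would lie in `Q`.
  obtain ⟨c, rfl⟩ := (hp.dvd_or_dvd h1).resolve_right fun h => hiQ ((hQ _).2 h)
  refine hjQ ((hQ _).2 (hcancel (fun s => bind₁ F (pderiv s w)) (fun l => ?_) j))
  rw [hderiv w _ hb]
  exact ⟨pderiv l (p * c) + c * pderiv l p, by ring⟩

end MvPolynomial

/-! ### Vanishing ideals -/

namespace ProjSpace

variable {k : ℕ}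

/-- The restriction of polynomials to the line in `ℂ^{k+1}` represented by `x`. -/
def line (x : ProjSpace k) : MvPolynomial (Fin (k + 1)) ℂ →ₐ[ℂ] Polynomial ℂ :=
  aeval fun i => Polynomial.C (x.coords i) * Polynomial.X

theorem eval_line (x : ProjSpace k) (t : ℂ) (g : MvPolynomial (Fin (k + 1)) ℂ) :
    (line x g).eval t = eval (t • x.coords) g := by
  induction g using MvPolynomial.induction_on with
  | C a => simp [line]
  | add p q hp hq => simp [hp, hq]
  | mul_X p i hp =>
    rw [map_mul, Polynomial.eval_mul, hp, map_mul]
    simp [line, mul_comm t]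

theorem line_eq_zero_iff (x : ProjSpace k) (g : MvPolynomial (Fin (k + 1)) ℂ) :
    line x g = 0 ↔ ∀ t : ℂ, eval (t • x.coords) g = 0 := by
  simp only [← eval_line]
  exact ⟨fun h t => by rw [h, Polynomial.eval_zero], fun h => Polynomial.funext (by simpa using h)⟩

/-- Vanishing on a line means vanishing of every homogeneous component there. Inhomogeneous
polynomials thus also cut out closed sets, and ideals can be used without tracking gradings. -/
theorem coeff_line (x : ProjSpace k) (n : ℕ) (g : MvPolynomial (Fin (k + 1)) ℂ) :
    (line x g).coeff n = eval x.coords (homogeneousComponent n g) := by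
  have : line x g = (DominatingMap.grade g).map (eval x.coords) := by
    induction g using MvPolynomial.induction_on with
    | C a => simp [line, DominatingMap.grade, Polynomial.algebraMap_apply]
    | add p q hp hq => simp [hp, hq]
    | mul_X p i hp =>
      rw [map_mul, hp, map_mul, Polynomial.map_mul]
      simp [line, DominatingMap.grade]
  rw [this, Polynomial.coeff_map, DominatingMap.coeff_grade]

theorem eval_smul_of_isHomogeneous {g : MvPolynomial (Fin (k + 1)) ℂ} {d : ℕ}
    (hg : g.IsHomogeneous d) (t : ℂ) (v : Fin (k + 1) → ℂ) :
    eval (t • v) g = t ^ d * eval v g := by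
  rw [eval_eq, eval_eq, Finset.mul_sum]
  refine Finset.sum_congr rfl fun m hm => ?_
  have : ∑ i ∈ m.support, m i = d := by
    rw [← hg (mem_support_iff.1 hm)]
    exact DFunLike.congr_fun Finsupp.degree_eq_weight_one m
  simp only [Pi.smul_apply, smul_eq_mul, mul_pow, Finset.prod_mul_distrib,
    Finset.prod_pow_eq_pow_sum, this]
  ring

theorem line_eq_zero_iff_of_isHomogeneous (x : ProjSpace k) {g : MvPolynomial (Fin (k + 1)) ℂ}
    {d : ℕ} (hg : g.IsHomogeneous d) : line x g = 0 ↔ eval x.coords g = 0 := by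
  rw [line_eq_zero_iff]
  refine ⟨fun h => by simpa using h 1, fun h t => ?_⟩
  rw [eval_smul_of_isHomogeneous hg, h, mul_zero]

theorem line_mk_eq_zero_iff {v : Fin (k + 1) → ℂ} (hv : v ≠ 0) (g : MvPolynomial (Fin (k + 1)) ℂ) :
    line (mk v hv) g = 0 ↔ ∀ t : ℂ, eval (t • v) g = 0 := by
  have h := (Projectivization.mk_eq_mk_iff' ℂ _ _ (coords_ne_zero (mk v hv)) hv).1
    (mk_coords (mk v hv))
  obtain ⟨a, ha⟩ := h
  have ha0 : a ≠ 0 := by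
    rintro rfl
    exact coords_ne_zero (mk v hv) (by rw [← ha, zero_smul])
  rw [line_eq_zero_iff, ← ha]
  refine ⟨fun h t => ?_, fun h t => ?_⟩
  · have := h (t * a⁻¹)
    rwa [smul_smul, mul_assoc, inv_mul_cancel₀ ha0, mul_one] at this
  · rw [smul_smul]
    exact h _

instance : Nonempty (ProjSpace k) := ⟨mk (fun _ => 1) fun h => one_ne_zero (congrFun h 0)⟩

/-- The hypersurface (or empty set, or whole space) cut out by a polynomial: the set of the lines
on which it vanishes. -/
def cutOut (g : MvPolynomial (Fin (k + 1)) ℂ) : Set (ProjSpace k) := {x | line x g = 0}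

theorem isClosed_cutOut (g : MvPolynomial (Fin (k + 1)) ℂ) : IsClosed (cutOut g) := by
  rw [isClosed_iff]
  refine ⟨Set.range fun n => homogeneousComponent n g, ?_, ?_⟩
  · rintro _ ⟨n, rfl⟩
    exact ⟨n, homogeneousComponent_isHomogeneous n g⟩
  · ext x
    simp [cutOut, zeroLocus, Polynomial.ext_iff, coeff_line]

theorem cutOut_mul (g h : MvPolynomial (Fin (k + 1)) ℂ) :
    cutOut (g * h) = cutOut g ∪ cutOut h := by
  ext x
  simp [cutOut]

theorem cutOut_mono {g h : MvPolynomial (Fin (k + 1)) ℂ} (hgh : g ∣ h) : cutOut g ⊆ cutOut h := by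
  obtain ⟨c, rfl⟩ := hgh
  rw [cutOut_mul]
  exact Set.subset_union_left

/-- The ideal of the polynomials vanishing on the cone over `A`. -/
def vanishing (A : Set (ProjSpace k)) : Ideal (MvPolynomial (Fin (k + 1)) ℂ) :=
  ⨅ x ∈ A, RingHom.ker (line x)

theorem mem_vanishing {A : Set (ProjSpace k)} {g : MvPolynomial (Fin (k + 1)) ℂ} :
    g ∈ vanishing A ↔ ∀ x ∈ A, line x g = 0 := by
  simp [vanishing, Submodule.mem_iInf, RingHom.mem_ker]

theorem mem_vanishing_iff_subset {A : Set (ProjSpace k)} {g : MvPolynomial (Fin (k + 1)) ℂ} :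
    g ∈ vanishing A ↔ A ⊆ cutOut g := mem_vanishing

theorem vanishing_anti {A B : Set (ProjSpace k)} (h : A ⊆ B) : vanishing B ≤ vanishing A :=
  fun _ hg => mem_vanishing.2 fun x hx => mem_vanishing.1 hg x (h hx)

theorem vanishing_closure (A : Set (ProjSpace k)) : vanishing (closure A) = vanishing A :=
  le_antisymm (vanishing_anti subset_closure) fun g hg =>
    mem_vanishing_iff_subset.2 (closure_minimal (mem_vanishing_iff_subset.1 hg) (isClosed_cutOut g))

theorem exists_isHomogeneous_of_notMem {A : Set (ProjSpace k)} (hA : IsClosed A) {x : ProjSpace k}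
    (hx : x ∉ A) : ∃ g ∈ vanishing A, (∃ d, g.IsHomogeneous d) ∧ line x g ≠ 0 := by
  obtain ⟨S, hS, rfl⟩ := (isClosed_iff A).1 hA
  simp only [zeroLocus, Set.mem_ofPred_eq, not_forall] at hx
  obtain ⟨g, hg, hgx⟩ := hx
  obtain ⟨d, hd⟩ := hS g hg
  exact ⟨g, mem_vanishing.2 fun y hy => (line_eq_zero_iff_of_isHomogeneous y hd).2 (hy g hg),
    ⟨d, hd⟩, fun h => hgx ((line_eq_zero_iff_of_isHomogeneous x hd).1 h)⟩

theorem vanishing_le_vanishing_iff {A B : Set (ProjSpace k)} (hB : IsClosed B) :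
    vanishing B ≤ vanishing A ↔ A ⊆ B := by
  refine ⟨fun h x hx => ?_, vanishing_anti⟩
  by_contra hxB
  obtain ⟨g, hg, -, hgx⟩ := exists_isHomogeneous_of_notMem hB hxB
  exact hgx (mem_vanishing.1 (h hg) x hx)

theorem vanishing_inj {A B : Set (ProjSpace k)} (hA : IsClosed A) (hB : IsClosed B)
    (h : vanishing A = vanishing B) : A = B :=
  Set.Subset.antisymm ((vanishing_le_vanishing_iff hB).1 h.ge)
    ((vanishing_le_vanishing_iff hA).1 h.le)

theorem vanishing_univ : vanishing (Set.univ : Set (ProjSpace k)) = ⊥ := by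
  rw [eq_bot_iff]
  intro g hg
  rw [mem_vanishing] at hg
  refine (Submodule.mem_bot _).2 (MvPolynomial.funext fun v => ?_)
  rw [map_zero]
  by_cases hv : v = 0
  · obtain ⟨x⟩ := (inferInstance : Nonempty (ProjSpace k))
    have := (line_eq_zero_iff x g).1 (hg x trivial) 0
    rwa [zero_smul, ← hv] at this
  · simpa using (line_mk_eq_zero_iff hv g).1 (hg _ trivial) 1

theorem vanishing_eq_bot_iff {A : Set (ProjSpace k)} (hA : IsClosed A) :
    vanishing A = ⊥ ↔ A = Set.univ :=
  ⟨fun h => vanishing_inj hA isClosed_univ (h.trans vanishing_univ.symm),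
    fun h => h ▸ vanishing_univ⟩

/-- Each `line x` maps to a domain, so products cut out unions; conversely, closed sets are
separated from outside points by polynomials. -/
theorem vanishing_isPrime_iff {A : Set (ProjSpace k)} :
    (vanishing A).IsPrime ↔ IsIrreducible A := by
  constructor
  · intro h
    refine ⟨?_, isPreirreducible_iff_isClosed_union_isClosed.2 fun B C hB hC hBC => ?_⟩
    · rw [Set.nonempty_iff_ne_empty]
      rintro rfl
      exact h.ne_top ((Ideal.eq_top_iff_one _).2 (mem_vanishing.2 fun x hx => hx.elim))
    · by_contra! hcon
      obtain ⟨⟨x, hxA, hxB⟩, y, hyA, hyC⟩ :=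
        And.intro (Set.not_subset.1 hcon.1) (Set.not_subset.1 hcon.2)
      obtain ⟨g, hg, -, hgx⟩ := exists_isHomogeneous_of_notMem hB hxB
      obtain ⟨g', hg', -, hgy⟩ := exists_isHomogeneous_of_notMem hC hyC
      have : g * g' ∈ vanishing A := mem_vanishing.2 fun z hz => by
        rw [map_mul, mul_eq_zero]
        exact (hBC hz).imp (mem_vanishing.1 hg z) (mem_vanishing.1 hg' z)
      rcases h.mem_or_mem this with h | h
      · exact hgx (mem_vanishing.1 h x hxA)
      · exact hgy (mem_vanishing.1 h y hyA)
  · rintro ⟨⟨x, hx⟩, h⟩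
    refine ⟨fun htop => ?_, fun {g g'} hgg => ?_⟩
    · have := mem_vanishing.1 ((Ideal.eq_top_iff_one _).1 htop) x hx
      simp at this
    · rw [mem_vanishing_iff_subset, cutOut_mul] at hgg
      simp only [mem_vanishing_iff_subset]
      exact isPreirreducible_iff_isClosed_union_isClosed.1 h _ _ (isClosed_cutOut g)
        (isClosed_cutOut g') hgg

theorem isIrreducible_univ : IsIrreducible (Set.univ : Set (ProjSpace k)) := by
  rw [← vanishing_isPrime_iff, vanishing_univ]
  exact Ideal.isPrime_bot

theorem mem_vanishing_cutOut (hk : k ≠ 0) {p : MvPolynomial (Fin (k + 1)) ℂ} (hp : Irreducible p)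
    {g : MvPolynomial (Fin (k + 1)) ℂ} {d : ℕ} (hd : p.IsHomogeneous d) :
    g ∈ vanishing (cutOut p) ↔ p ∣ g := by
  refine ⟨fun hg => ?_, fun h => mem_vanishing_iff_subset.2 (cutOut_mono h)⟩
  have hprime : Prime p := hp.prime
  -- The Nullstellensatz needs vanishing on the whole affine zero set of `p`. The factor `X i` takes
  -- care of the origin, which represents no point of projective space.
  have hX : ∀ i, p ∣ g * X i := by
    intro i
    have : (Ideal.span {p} : Ideal (MvPolynomial (Fin (k + 1)) ℂ)).IsPrime :=
      (Ideal.span_singleton_prime hprime.ne_zero).2 hprime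
    rw [← Ideal.mem_span_singleton,
      ← IsPrime.vanishingIdeal_zeroLocus (K := ℂ) (Ideal.span {p}), mem_vanishingIdeal_iff]
    intro v hv
    have hpv : eval v p = 0 := by
      simpa [aeval_eq_eval] using (mem_zeroLocus_iff.1 hv) p (Ideal.mem_span_singleton_self p)
    by_cases hv0 : v = 0
    · simp [hv0]
    · have h1 : mk v hv0 ∈ cutOut p := (line_mk_eq_zero_iff hv0 p).2 fun t => by
        rw [eval_smul_of_isHomogeneous hd, hpv, mul_zero]
      have h2 := (line_mk_eq_zero_iff hv0 g).1 (mem_vanishing.1 hg _ h1) 1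
      rw [one_smul] at h2
      simp [aeval_eq_eval, h2]
  by_contra hpg
  -- Otherwise `p` would be associated to every variable, impossible when there are at least two of
  -- them.
  have h01 : ∀ i, Associated p (X i) := fun i =>
    hp.associated_of_dvd X_prime.irreducible ((hprime.dvd_or_dvd (hX i)).resolve_left hpg)
  have h02 : (X 0 : MvPolynomial (Fin (k + 1)) ℂ) ∣ X (Fin.last k) :=
    ((h01 0).symm.trans (h01 (Fin.last k))).dvd
  rw [X_dvd_X] at h02
  exact hk (by simpa [Fin.ext_iff] using h02.symm)

theorem vanishing_cutOut (hk : k ≠ 0) {p : MvPolynomial (Fin (k + 1)) ℂ} (hp : Irreducible p)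
    {d : ℕ} (hd : p.IsHomogeneous d) : vanishing (cutOut p) = Ideal.span {p} := by
  ext g
  rw [mem_vanishing_cutOut hk hp hd, Ideal.mem_span_singleton]

theorem isIrreducible_cutOut (hk : k ≠ 0) {p : MvPolynomial (Fin (k + 1)) ℂ} (hp : Irreducible p)
    {d : ℕ} (hd : p.IsHomogeneous d) : IsIrreducible (cutOut p) := by
  rw [← vanishing_isPrime_iff, vanishing_cutOut hk hp hd]
  exact (Ideal.span_singleton_prime hp.ne_zero).2 hp.prime

/-- An irreducible set on which a homogeneous polynomial vanishes lies in the hypersurface of one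
of its irreducible factors. -/
theorem exists_irreducible_factor {A : Set (ProjSpace k)} (hA : IsIrreducible A)
    {g : MvPolynomial (Fin (k + 1)) ℂ} {d : ℕ} (hd : g.IsHomogeneous d) (hg0 : g ≠ 0)
    (hg : g ∈ vanishing A) :
    ∃ p, Irreducible p ∧ (∃ e, p.IsHomogeneous e) ∧ p ∣ g ∧ A ⊆ cutOut p := by
  have hprime := vanishing_isPrime_iff.2 hA
  obtain ⟨p, hp, hpA⟩ := (hprime.multiset_prod_mem_iff_exists_mem
    (UniqueFactorizationMonoid.factors g)).1 <| by
      obtain ⟨u, hu⟩ := UniqueFactorizationMonoid.factors_prod hg0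
      rw [← hu] at hg
      exact (hprime.mem_or_mem hg).resolve_right fun h =>
        hprime.ne_top (Ideal.eq_top_of_isUnit_mem _ h u.isUnit)
  have hpg := UniqueFactorizationMonoid.dvd_of_mem_factors hp
  obtain ⟨c, rfl⟩ := hpg
  obtain ⟨a, b, ha, -, -⟩ := DominatingMap.isHomogeneous_of_mul hg0 hd
  exact ⟨p, UniqueFactorizationMonoid.irreducible_of_factor p hp, ⟨a, ha⟩, dvd_mul_right p c,
    mem_vanishing_iff_subset.1 hpA⟩

/-! ### Codimension -/

theorem codim_anti {A B : Set (ProjSpace k)} (h : A ⊆ B) : codim B ≤ codim A :=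
  le_iInf₂ fun Z hZ => iInf₂_le Z (hZ.trans h)

theorem codim_eq_coheight (Z : TopologicalSpace.IrreducibleCloseds (ProjSpace k)) :
    codim (Z : Set (ProjSpace k)) = Order.coheight Z :=
  le_antisymm (iInf₂_le Z Set.Subset.rfl) (le_iInf₂ fun _ hY => Order.coheight_anti hY)

theorem codim_eq_zero_iff {A : Set (ProjSpace k)} (hA : IsIrreducible A) (hc : IsClosed A) :
    codim A = 0 ↔ A = Set.univ := by
  rw [show A = ((⟨A, hA, hc⟩ : TopologicalSpace.IrreducibleCloseds (ProjSpace k)) :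
    Set (ProjSpace k)) from rfl, codim_eq_coheight, Order.coheight_eq_zero]
  constructor
  · intro h
    exact Set.eq_univ_of_forall fun x =>
      h (b := ⟨Set.univ, isIrreducible_univ, isClosed_univ⟩) (fun y _ => Set.mem_univ y)
        (Set.mem_univ x)
  · intro h Z _ x _
    exact Set.eq_univ_iff_forall.1 h x

theorem codim_strictAnti {A B : Set (ProjSpace k)} (hA : IsIrreducible A) (hcA : IsClosed A)
    (hB : IsIrreducible B) (hcB : IsClosed B) (h : A ⊂ B) : codim B + 1 ≤ codim A := by
  have := Order.coheight_add_one_le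
    (a := (⟨B, hB, hcB⟩ : TopologicalSpace.IrreducibleCloseds (ProjSpace k)))
    (b := ⟨A, hA, hcA⟩) (lt_iff_le_not_ge.2 ⟨h.1, h.2⟩)
  rwa [← codim_eq_coheight, ← codim_eq_coheight] at this

/-- A closed irreducible set whose vanishing ideal is principal has codimension at most one. -/
theorem codim_le_one {A : Set (ProjSpace k)} (hA : IsIrreducible A) (hc : IsClosed A)
    {g : MvPolynomial (Fin (k + 1)) ℂ} (hg : Irreducible g) (h : vanishing A = Ideal.span {g}) :
    codim A ≤ 1 := by
  rw [show A = ((⟨A, hA, hc⟩ : TopologicalSpace.IrreducibleCloseds (ProjSpace k)) :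
    Set (ProjSpace k)) from rfl, codim_eq_coheight]
  refine Order.coheight_le_coe_iff.2 fun Y hY => ?_
  rw [← codim_eq_coheight, Nat.cast_one, Order.lt_one_iff,
    codim_eq_zero_iff Y.isIrreducible Y.isClosed, ← vanishing_eq_bot_iff Y.isClosed, eq_bot_iff]
  have hAY : A ⊆ Y := hY.le
  have hle : vanishing (Y : Set (ProjSpace k)) ≤ Ideal.span {g} := h ▸ vanishing_anti hAY
  have hprime := vanishing_isPrime_iff.2 Y.isIrreducible
  have hgY : g ∉ vanishing (Y : Set (ProjSpace k)) := by
    rw [← Ideal.span_singleton_le_iff_mem, ← h, vanishing_le_vanishing_iff hc]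
    exact fun hYA => hY.not_ge hYA
  -- Principal ideal argument: write `r = g ^ n * c` with `g ∤ c`. The prime ideal of `Y` omits `g`,
  -- so it contains `c`, yet it lies inside the ideal generated by `g`.
  intro r hr
  by_contra hr0
  obtain ⟨c, hc, hcg⟩ :=
    (FiniteMultiplicity.of_not_isUnit hg.not_isUnit hr0).exists_eq_pow_mul_and_not_dvd
  rw [hc] at hr
  refine hcg (Ideal.mem_span_singleton.1 (hle ?_))
  exact (hprime.mem_or_mem hr).resolve_left fun h' => hgY (hprime.mem_of_pow_mem _ h')

theorem codim_cutOut (hk : k ≠ 0) {p : MvPolynomial (Fin (k + 1)) ℂ} (hp : Irreducible p)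
    {d : ℕ} (hd : p.IsHomogeneous d) : codim (cutOut p) = 1 := by
  have hirr := isIrreducible_cutOut hk hp hd
  refine le_antisymm
    (codim_le_one hirr (isClosed_cutOut p) hp (vanishing_cutOut hk hp hd)) ?_
  rw [Order.one_le_iff_ne_zero, Ne, codim_eq_zero_iff hirr (isClosed_cutOut p),
    ← vanishing_eq_bot_iff (isClosed_cutOut p), vanishing_cutOut hk hp hd,
    Ideal.span_singleton_eq_bot]
  exact hp.ne_zero

/-- A closed irreducible set of codimension one is cut out by an irreducible polynomial. -/
theorem exists_eq_cutOut (hk : k ≠ 0) {A : Set (ProjSpace k)} (hA : IsIrreducible A)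
    (hc : IsClosed A) (h : codim A = 1) :
    ∃ p d, Irreducible p ∧ p.IsHomogeneous d ∧ A = cutOut p := by
  obtain ⟨x, hx⟩ : ∃ x, x ∉ A := by
    by_contra! hall
    rw [(codim_eq_zero_iff hA hc).2 (Set.eq_univ_of_forall hall)] at h
    exact zero_ne_one h
  obtain ⟨g, hg, ⟨d, hd⟩, hgx⟩ := exists_isHomogeneous_of_notMem hc hx
  have hg0 : g ≠ 0 := by
    rintro rfl
    exact hgx (map_zero _)
  obtain ⟨p, hp, ⟨e, he⟩, -, hAp⟩ := exists_irreducible_factor hA hd hg0 hg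
  refine ⟨p, e, hp, he, by_contra fun hne => ?_⟩
  have := codim_strictAnti hA hc (isIrreducible_cutOut hk hp he) (isClosed_cutOut p)
    (hAp.ssubset_of_ne hne)
  rw [h, codim_cutOut hk hp he] at this
  exact absurd this (by decide)

/-- Closed irreducible subsets of codimension one which are contained in each other are equal. -/
theorem eq_of_subset_of_codim_eq {A B : Set (ProjSpace k)} (hA : IsIrreducible A)
    (hcA : IsClosed A) (hB : IsIrreducible B) (hcB : IsClosed B) (h1 : codim A = 1)
    (h2 : codim B = 1) (h : A ⊆ B) : A = B := by
  by_contra hne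
  have := codim_strictAnti hA hcA hB hcB (h.ssubset_of_ne hne)
  rw [h1, h2] at this
  exact absurd this (by decide)

/-! ### Components -/

theorem isComponent_self {A : Set (ProjSpace k)} (hA : IsIrreducible A) : IsComponent A A :=
  ⟨⟨hA, subset_rfl⟩, fun _ h _ => h.2⟩

theorem isHypersurface_iff {A : Set (ProjSpace k)} (hA : IsIrreducible A) (hc : IsClosed A) :
    IsHypersurface A ↔ codim A = 1 := by
  refine ⟨fun h => h.2.2 A (isComponent_self hA), fun h => ⟨hc, hA.nonempty, fun Z hZ => ?_⟩⟩
  rw [hZ.1.2.antisymm (hZ.2 ⟨hA, subset_rfl⟩ hZ.1.2), h]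

theorem IsComponent.isClosed {Z A : Set (ProjSpace k)} (hA : IsClosed A) (h : IsComponent Z A) :
    IsClosed Z :=
  isClosed_of_closure_subset
    (h.2 ⟨h.1.1.closure, closure_minimal h.1.2 hA⟩ subset_closure)

/-- Zorn's lemma: the union of a chain of irreducible sets is irreducible, because any two of its
points lie in a common member. -/
theorem exists_isComponent {Y A : Set (ProjSpace k)} (hY : IsIrreducible Y) (h : Y ⊆ A) :
    ∃ Z, IsComponent Z A ∧ Y ⊆ Z := by
  obtain ⟨Z, hYZ, hZ⟩ := zorn_subset_nonempty
    {Y : Set (ProjSpace k) | IsIrreducible Y ∧ Y ⊆ A} (fun c hc hchain hne => by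
      obtain ⟨s, hs⟩ := hne
      refine ⟨⋃₀ c, ⟨⟨(hc hs).1.nonempty.mono (Set.subset_sUnion_of_mem hs), ?_⟩,
        Set.sUnion_subset fun t ht => (hc ht).2⟩, fun t ht => Set.subset_sUnion_of_mem ht⟩
      rintro u v hu hv ⟨y, ⟨p, hpc, hyp⟩, hyu⟩ ⟨x, ⟨q, hqc, hxq⟩, hxv⟩
      rcases hchain.total hpc hqc with hpq | hqp
      · obtain ⟨z, hz, h'⟩ := (hc hqc).1.2 u v hu hv ⟨y, hpq hyp, hyu⟩ ⟨x, hxq, hxv⟩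
        exact ⟨z, ⟨q, hqc, hz⟩, h'⟩
      · obtain ⟨z, hz, h'⟩ := (hc hpc).1.2 u v hu hv ⟨y, hyp, hyu⟩ ⟨x, hqp hxq, hxv⟩
        exact ⟨z, ⟨p, hpc, hz⟩, h'⟩) Y ⟨hY, h⟩
  exact ⟨Z, hZ, hYZ⟩

/-- The irreducible sets in a finite union of closed sets lie in one of them. -/
theorem exists_subset_of_subset_sUnion {S : Set (Set (ProjSpace k))} (hS : S.Finite)
    (hc : ∀ B ∈ S, IsClosed B) {A : Set (ProjSpace k)} (hA : IsIrreducible A) (h : A ⊆ ⋃₀ S) :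
    ∃ B ∈ S, A ⊆ B := by
  have := isIrreducible_iff_sUnion_isClosed.1 hA hS.toFinset (by simpa using hc) (by simpa using h)
  simpa using this

end ProjSpace

/-! ### Images and iterates -/

namespace DominatingMap

open ProjSpace

variable {k : ℕ}

theorem deg_pos (f : DominatingMap k) : 0 < f.deg := by
  rw [Nat.pos_iff_ne_zero]
  intro h
  refine f.dominating (Matrix.det_eq_zero_of_row_eq_zero 0 fun j => ?_)
  have := (totalDegree_zero_iff_isHomogeneous _).2 (h ▸ f.homogeneous 0)
  rw [totalDegree_eq_zero_iff_eq_C] at this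
  simp only [polyJacobian, Matrix.of_apply]
  rw [this, pderiv_C]

theorem mem_indet {f : DominatingMap k} {x : ProjSpace k} :
    x ∈ f.indet ↔ ∀ i, line x (f.F i) = 0 := by
  simp [indet, ProjSpace.zeroLocus, fun i => line_eq_zero_iff_of_isHomogeneous x (f.homogeneous i)]

theorem subset_indet_iff {f : DominatingMap k} {A : Set (ProjSpace k)} :
    A ⊆ f.indet ↔ ∀ i, f.F i ∈ vanishing A := by
  simp only [mem_vanishing, Set.subset_def, mem_indet]
  exact ⟨fun h i x hx => h x hx i, fun h x hx i => h i x hx⟩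

/-- Polynomials vanish at the point with homogeneous coordinates `P i x` exactly if their
pull-backs under `P` vanish at `x`. -/
theorem line_mk_eval_eq_zero_iff {P : Fin (k + 1) → MvPolynomial (Fin (k + 1)) ℂ} {d : ℕ}
    (hP : ∀ i, (P i).IsHomogeneous d) (hd : 0 < d) {x : ProjSpace k}
    (hx : (fun i => eval x.coords (P i)) ≠ 0) (g : MvPolynomial (Fin (k + 1)) ℂ) :
    line (ProjSpace.mk _ hx) g = 0 ↔ line x (bind₁ P g) = 0 := by
  have key : ∀ t : ℂ, eval (t • x.coords) (bind₁ P g) =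
      eval (t ^ d • fun i => eval x.coords (P i)) g := by
    intro t
    have : (t ^ d • fun i => eval x.coords (P i)) = fun i => eval (t • x.coords) (P i) := by
      funext i
      rw [eval_smul_of_isHomogeneous (hP i)]
      rfl
    rw [this]
    exact eval₂Hom_bind₁ _ _ _ _
  rw [line_mk_eq_zero_iff, line_eq_zero_iff]
  refine ⟨fun h t => by rw [key, h], fun h t => ?_⟩
  -- The lifting maps a line to a line by `t ↦ t ^ d`, which is surjective on `ℂ` since `d > 0`.
  obtain ⟨z, rfl⟩ := IsAlgClosed.exists_pow_nat_eq t hd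
  rw [← key, h]

/-- The vanishing ideal of the image of an irreducible set, computed with any lifting (with or
without common factors) that does not vanish on the set. -/
theorem vanishing_image (f : DominatingMap k) {P : Fin (k + 1) → MvPolynomial (Fin (k + 1)) ℂ}
    {d : ℕ} (hP : ∀ i, (P i).IsHomogeneous d) (hd : 0 < d) {q : MvPolynomial (Fin (k + 1)) ℂ}
    (hq : ∀ i, P i = q * f.F i) {A : Set (ProjSpace k)} (hA : IsIrreducible A)
    {i₀ : Fin (k + 1)} (hi₀ : P i₀ ∉ vanishing A) :
    vanishing (f.image A) = (vanishing A).comap (bind₁ P) := by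
  have hprime := vanishing_isPrime_iff.2 hA
  -- Where `P i₀` does not vanish, `P` and `f.F` differ by a nonzero scalar and define the same
  -- image point.
  have hval : ∀ x, line x (P i₀) ≠ 0 → ∃ hx : x ∉ f.indet, ∀ g,
      line (f.apply x hx) g = 0 ↔ line x (bind₁ P g) = 0 := by
    intro x hx
    have hPx : (fun i => eval x.coords (P i)) ≠ 0 := fun h =>
      hx ((line_eq_zero_iff_of_isHomogeneous x (hP i₀)).2 (congrFun h i₀))
    have hxf : x ∉ f.indet := fun h => hx (by rw [hq, map_mul, mem_indet.1 h, mul_zero])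
    refine ⟨hxf, fun g => ?_⟩
    rw [← line_mk_eval_eq_zero_iff hP hd hPx]
    have : f.apply x hxf = ProjSpace.mk _ hPx := by
      refine ((Projectivization.mk_eq_mk_iff' ℂ _ _ hPx (f.value_ne_zero hxf)).2
        ⟨eval x.coords q, ?_⟩).symm
      funext i
      simp [value, hq]
    rw [this]
  rw [image, vanishing_closure]
  ext g
  rw [Ideal.mem_comap]
  -- By primality of the ideal of `A`, the points with `P i₀ = 0` can be ignored.
  have hcancel : ∀ h, (∀ x ∈ A, line x (P i₀) ≠ 0 → line x h = 0) → h ∈ vanishing A := by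
    intro h hh
    refine (hprime.mem_or_mem (mem_vanishing.2 fun x hx => ?_ : P i₀ * h ∈ _)).resolve_left hi₀
    rw [map_mul]
    by_cases h0 : line x (P i₀) = 0
    · rw [h0, zero_mul]
    · rw [hh x hx h0, mul_zero]
  constructor
  · intro hg
    refine hcancel _ fun x hx h0 => ?_
    obtain ⟨hxf, h1⟩ := hval x h0
    exact (h1 g).1 (mem_vanishing.1 hg _ ⟨x, hxf, hx, rfl⟩)
  · intro hg
    -- Points outside `I(f)` where `P i₀` vanishes also contribute to the image; passing to the
    -- reduced lifting `f.F` covers them.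
    have : bind₁ f.F g ∈ vanishing A := hcancel _ fun x hx h0 => by
      obtain ⟨hxf, h1⟩ := hval x h0
      rw [← line_mk_eval_eq_zero_iff f.homogeneous f.deg_pos (f.value_ne_zero hxf)]
      exact (h1 g).2 (mem_vanishing.1 hg x hx)
    rw [mem_vanishing]
    rintro _ ⟨x, hxf, hx, rfl⟩
    exact (line_mk_eval_eq_zero_iff f.homogeneous f.deg_pos (f.value_ne_zero hxf) g).2
      (mem_vanishing.1 this x hx)

/-! ### Iterates of the lifting and images under iterates -/

/-- The pull-back of polynomials under the `n`-th iterate of the lifting of `f`. -/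
def pull (f : DominatingMap k) (n : ℕ) :
    MvPolynomial (Fin (k + 1)) ℂ →ₐ[ℂ] MvPolynomial (Fin (k + 1)) ℂ := (bind₁ f.F) ^ n

theorem pull_add (f : DominatingMap k) (m n : ℕ) (g : MvPolynomial (Fin (k + 1)) ℂ) :
    f.pull (m + n) g = f.pull m (f.pull n g) := by
  rw [pull, pow_add]
  rfl

theorem pull_succ (f : DominatingMap k) (n : ℕ) (g : MvPolynomial (Fin (k + 1)) ℂ) :
    f.pull (n + 1) g = bind₁ f.F (f.pull n g) := by
  rw [pull, pow_succ']
  rfl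

theorem pull_one (f : DominatingMap k) : f.pull 1 = bind₁ f.F := pow_one _

theorem pull_zero (f : DominatingMap k) (g : MvPolynomial (Fin (k + 1)) ℂ) : f.pull 0 g = g := rfl

theorem pull_one_X (f : DominatingMap k) (i : Fin (k + 1)) : f.pull 1 (X i) = f.F i := by
  rw [pull_one, bind₁_X_right]

theorem bind₁_pull_X (f : DominatingMap k) (n : ℕ) :
    bind₁ (fun i => f.pull n (X i)) = f.pull n :=
  algHom_ext fun i => by rw [bind₁_X_right]

theorem isHomogeneous_pull_X (f : DominatingMap k) (n : ℕ) (i : Fin (k + 1)) :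
    (f.pull n (X i)).IsHomogeneous (f.deg ^ n) := by
  induction n with
  | zero => simpa [pull_zero] using isHomogeneous_X ℂ i
  | succ n ih =>
    rw [pull_succ, pow_succ']
    exact ih.aeval _ f.homogeneous

theorem pull_injective (f : DominatingMap k) (n : ℕ) : Function.Injective (f.pull n) := by
  induction n with
  | zero => exact fun _ _ h => h
  | succ n ih =>
    have h1 : Function.Injective (bind₁ f.F) := by
      rw [injective_iff_map_eq_zero]
      intro p hp
      by_contra h
      exact bind₁_ne_zero f.dominating h hp
    intro a b hab
    rw [pull_succ, pull_succ] at hab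
    exact ih (h1 hab)

/-- The common factors removed at each composition accumulate in `q`. The indices differ by one
because `iterateSucc n` is `f^(n+1)`. -/
theorem exists_pull_X_eq (f : DominatingMap k) (n : ℕ) :
    ∃ q, ∀ i, f.pull (n + 1) (X i) = q * (f.iterateSucc n).F i := by
  induction n with
  | zero => exact ⟨1, fun i => by rw [zero_add, pull_one_X, one_mul]; rfl⟩
  | succ n ih =>
    obtain ⟨q, hq⟩ := ih
    obtain ⟨r, -, hr⟩ := (f.iterateSucc n).comp_spec f
    refine ⟨bind₁ f.F q * r, fun i => ?_⟩
    rw [pull_succ, hq, map_mul, hr, mul_assoc]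
    rfl

theorem isClosed_iterImage (f : DominatingMap k) (n : ℕ) {A : Set (ProjSpace k)}
    (hA : IsClosed A) : IsClosed (f.iterImage n A) := by
  cases n with
  | zero => exact hA
  | succ n => exact isClosed_closure

theorem image_mono (f : DominatingMap k) {A B : Set (ProjSpace k)} (h : A ⊆ B) :
    f.image A ⊆ f.image B :=
  closure_mono fun _ ⟨x, hx, hxA, hy⟩ => ⟨x, hx, h hxA, hy⟩

theorem iterImage_mono (f : DominatingMap k) (n : ℕ) {A B : Set (ProjSpace k)} (h : A ⊆ B) :
    f.iterImage n A ⊆ f.iterImage n B := by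
  cases n with
  | zero => exact h
  | succ n => exact image_mono _ h

theorem image_sUnion (f : DominatingMap k) {S : Set (Set (ProjSpace k))} (hS : S.Finite) :
    f.image (⋃₀ S) = ⋃ A ∈ S, f.image A := by
  unfold image
  rw [← hS.closure_biUnion]
  congr 1
  ext y
  simp only [Set.mem_ofPred_eq, Set.mem_iUnion, Set.mem_sUnion]
  exact ⟨fun ⟨x, hx, ⟨A, hA, hxA⟩, h⟩ => ⟨A, hA, x, hx, hxA, h⟩,
    fun ⟨A, hA, x, hx, hxA, h⟩ => ⟨x, hx, ⟨A, hA, hxA⟩, h⟩⟩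

theorem iterImage_sUnion (f : DominatingMap k) (n : ℕ) {S : Set (Set (ProjSpace k))}
    (hS : S.Finite) : f.iterImage n (⋃₀ S) = ⋃ A ∈ S, f.iterImage n A := by
  cases n with
  | zero => exact Set.sUnion_eq_biUnion
  | succ n => exact image_sUnion _ hS

/-- The lifting of `f^n`, before removal of common factors, does not vanish identically on `A`. -/
def LiftNonzero (f : DominatingMap k) (n : ℕ) (A : Set (ProjSpace k)) : Prop :=
  ∃ i, f.pull n (X i) ∉ vanishing A

theorem vanishing_iterImage (f : DominatingMap k) {n : ℕ} {A : Set (ProjSpace k)}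
    (hA : IsIrreducible A) (h : f.LiftNonzero n A) :
    vanishing (f.iterImage n A) = (vanishing A).comap (f.pull n) := by
  cases n with
  | zero => rfl
  | succ n =>
    obtain ⟨i, hi⟩ := h
    obtain ⟨q, hq⟩ := f.exists_pull_X_eq n
    have := vanishing_image (f.iterateSucc n) (f.isHomogeneous_pull_X (n + 1))
      (pow_pos f.deg_pos _) hq hA hi
    rwa [bind₁_pull_X] at this

theorem isIrreducible_iterImage (f : DominatingMap k) {n : ℕ} {A : Set (ProjSpace k)}
    (hA : IsIrreducible A) (h : f.LiftNonzero n A) : IsIrreducible (f.iterImage n A) := by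
  have := vanishing_isPrime_iff.2 hA
  rw [← vanishing_isPrime_iff, vanishing_iterImage f hA h]
  exact Ideal.comap_isPrime _ _

theorem liftNonzero_zero (f : DominatingMap k) {A : Set (ProjSpace k)} (hA : A.Nonempty) :
    f.LiftNonzero 0 A := by
  obtain ⟨x, hx⟩ := hA
  by_contra! h
  simp only [LiftNonzero, not_exists, not_not] at h
  refine x.coords_ne_zero (funext fun i => ?_)
  have := (line_eq_zero_iff x _).1 (mem_vanishing.1 (h i) x hx) 1
  simpa [pull_zero] using this

/-- The components of the next unreduced lifting are the pull-backs of the `F i`; they vanish on `A`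
exactly when the `F i` vanish on `f^n(A)`. -/
theorem liftNonzero_succ_iff (f : DominatingMap k) {n : ℕ} {A : Set (ProjSpace k)}
    (hA : IsIrreducible A) (h : f.LiftNonzero n A) :
    f.LiftNonzero (n + 1) A ↔ ¬ f.iterImage n A ⊆ f.indet := by
  rw [subset_indet_iff, vanishing_iterImage f hA h, not_forall]
  refine exists_congr fun i => ?_
  rw [Ideal.mem_comap, pull_add, pull_one_X]

theorem liftNonzero_of_forall_lt (f : DominatingMap k) {n : ℕ} {A : Set (ProjSpace k)}
    (hA : IsIrreducible A) (h : ∀ l < n, ¬ f.iterImage l A ⊆ f.indet) : f.LiftNonzero n A := by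
  induction n with
  | zero => exact f.liftNonzero_zero hA.nonempty
  | succ n ih =>
    exact (f.liftNonzero_succ_iff hA (ih fun l hl => h l (hl.trans n.lt_succ_self))).2
      (h n n.lt_succ_self)

/-- Both sides have as ideal the contraction of the ideal of `A` along `pull (m + n)`. The identity
breaks down once an intermediate image falls into `I(f)`, as the image of a subset of `I(f)` under
`f` is empty. -/
theorem iterImage_iterImage (f : DominatingMap k) {m n : ℕ} {A : Set (ProjSpace k)}
    (hA : IsIrreducible A) (hc : IsClosed A) (hm : f.LiftNonzero m A)
    (h : f.LiftNonzero (m + n) A) :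
    f.iterImage n (f.iterImage m A) = f.iterImage (m + n) A := by
  have hB := f.isIrreducible_iterImage hA hm
  have hn : f.LiftNonzero n (f.iterImage m A) := by
    obtain ⟨i, hi⟩ := h
    refine ⟨i, ?_⟩
    rwa [vanishing_iterImage f hA hm, Ideal.mem_comap, ← pull_add]
  refine vanishing_inj (f.isClosed_iterImage n (f.isClosed_iterImage m hc))
    (f.isClosed_iterImage _ hc) ?_
  rw [vanishing_iterImage f hB hn, vanishing_iterImage f hA hm, vanishing_iterImage f hA h]
  ext g
  simp only [Ideal.mem_comap, pull_add]

/-- Dominance makes the pull-back injective, so the zero ideal contracts to the zero ideal. -/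
theorem iterImage_univ (f : DominatingMap k) (n : ℕ) :
    f.iterImage n Set.univ = Set.univ := by
  have h : f.LiftNonzero n Set.univ := ⟨0, by
    rw [vanishing_univ, Submodule.mem_bot]
    exact (map_ne_zero_iff _ (f.pull_injective n)).2 (X_ne_zero 0)⟩
  rw [← vanishing_eq_bot_iff (f.isClosed_iterImage n isClosed_univ),
    vanishing_iterImage f isIrreducible_univ h, vanishing_univ, eq_bot_iff]
  intro g hg
  exact (map_eq_zero_iff _ (f.pull_injective n)).1 hg

/-! ### The indeterminacy locus and contracted hypersurfaces -/

/-- The indeterminacy locus has codimension at least two. -/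
theorem one_lt_codim_of_subset_indet (f : DominatingMap k) {A : Set (ProjSpace k)}
    (hA : A ⊆ f.indet) : 1 < codim A := by
  have key : ∀ Z : Set (ProjSpace k), IsIrreducible Z → IsClosed Z → Z ⊆ f.indet →
      2 ≤ codim Z := by
    intro Z hZ hcZ hZf
    obtain ⟨i, hi⟩ : ∃ i, f.F i ≠ 0 := by
      by_contra! h
      exact not_isUnit_zero (f.coprime 0 fun i => by rw [h i])
    obtain ⟨p, hp, ⟨e, he⟩, -, hZp⟩ := exists_irreducible_factor hZ (f.homogeneous i) hi
      (subset_indet_iff.1 hZf i)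
    -- If a whole hypersurface `V(p)` lay in `I(f)`, then `p` would be a common factor of the
    -- components.
    have hne : Z ≠ cutOut p := by
      rintro rfl
      exact hp.not_isUnit (f.coprime p fun j =>
        (mem_vanishing_cutOut f.k_ne_zero hp he).1 (subset_indet_iff.1 hZf j))
    have := codim_strictAnti hZ hcZ (isIrreducible_cutOut f.k_ne_zero hp he) (isClosed_cutOut p)
      (hZp.ssubset_of_ne hne)
    rwa [codim_cutOut f.k_ne_zero hp he, one_add_one_eq_two] at this
  have : (2 : ℕ∞) ≤ codim A := le_iInf₂ fun Z hZ => by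
    rw [← codim_eq_coheight]
    exact key Z Z.isIrreducible Z.isClosed (hZ.trans hA)
  exact lt_of_lt_of_le (by decide) this

/-- A hypersurface whose image has higher codimension lies in the critical set. -/
theorem dvd_det_of_one_lt_codim (f : DominatingMap k) {p : MvPolynomial (Fin (k + 1)) ℂ}
    (hp : Irreducible p) {d : ℕ} (hd : p.IsHomogeneous d)
    (h : 1 < codim (f.iterImage 1 (cutOut p))) : p ∣ (polyJacobian f.F).det := by
  by_contra hJ
  have hk := f.k_ne_zero
  have hirr := isIrreducible_cutOut hk hp hd
  have hcl := isClosed_cutOut p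
  have h1 : f.LiftNonzero 1 (cutOut p) := f.liftNonzero_of_forall_lt hirr fun l hl hsub => by
    rw [Nat.lt_one_iff.1 hl] at hsub
    have := f.one_lt_codim_of_subset_indet hsub
    rw [iterImage, codim_cutOut hk hp hd] at this
    exact lt_irrefl _ this
  have hirr' := f.isIrreducible_iterImage hirr h1
  have hcl' := f.isClosed_iterImage 1 hcl
  have hQ0 : vanishing (f.iterImage 1 (cutOut p)) ≠ ⊥ := by
    rw [Ne, vanishing_eq_bot_iff hcl', ← codim_eq_zero_iff hirr' hcl']
    exact (zero_lt_one.trans h).ne'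
  obtain ⟨g, hg, hgQ⟩ := eq_span_singleton_of_not_dvd_det hp.prime hJ (fun g => by
    rw [vanishing_iterImage f hirr h1, Ideal.mem_comap, pull_one,
      mem_vanishing_cutOut hk hp hd]) hQ0
  exact absurd (codim_le_one hirr' hcl' hg hgQ) (not_le.2 h)

end DominatingMap

/-! ### Primitive degree lowering hypersurfaces -/

namespace DominatingMap

open ProjSpace

variable {k : ℕ}

/-- An irreducible degree lowering hypersurface of height `n` whose images up to the time `n` all
have codimension at least two. -/
structure IsPrimitive (f : DominatingMap k) (n : ℕ) (Z : Set (ProjSpace k)) : Prop where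
  irreducible : IsIrreducible Z
  isClosed : IsClosed Z
  codim_eq : codim Z = 1
  height : f.HasHeight Z n
  codim_image : ∀ m, 1 ≤ m → m ≤ n → 1 < codim (f.iterImage m Z)

theorem HasHeight.unique {f : DominatingMap k} {A : Set (ProjSpace k)} {m n : ℕ}
    (hm : f.HasHeight A m) (hn : f.HasHeight A n) : m = n := IsLeast.unique hm hn

theorem not_subset_indet_of_codim_eq {f : DominatingMap k} {A : Set (ProjSpace k)}
    (h : ProjSpace.codim A = 1) : ¬ A ⊆ f.indet := fun hsub =>
  absurd (f.one_lt_codim_of_subset_indet hsub) (by rw [h]; exact lt_irrefl _)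

/-- Heights are at least one, so already `f` contracts a primitive hypersurface; its equation is, up
to a unit, one of the irreducible factors of the Jacobian determinant. -/
theorem finite_isPrimitive (f : DominatingMap k) :
    {Z | ∃ n, f.IsPrimitive n Z}.Finite := by
  classical
  refine ((UniqueFactorizationMonoid.factors (polyJacobian f.F).det).toFinset.finite_toSet.image
    cutOut).subset ?_
  rintro Z ⟨n, hZ⟩
  obtain ⟨p, d, hp, hd, rfl⟩ := exists_eq_cutOut f.k_ne_zero hZ.irreducible hZ.isClosed hZ.codim_eq
  have hdvd := f.dvd_det_of_one_lt_codim hp hd (hZ.codim_image 1 le_rfl hZ.height.1.1)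
  obtain ⟨q, hq, hpq⟩ :=
    UniqueFactorizationMonoid.exists_mem_factors_of_dvd f.dominating hp hdvd
  exact ⟨q, by simpa using hq, (cutOut_mono hpq.symm.dvd).antisymm (cutOut_mono hpq.dvd)⟩

/-- The union of the primitive degree lowering hypersurfaces of height `n`. -/
def primitiveUnion (f : DominatingMap k) (n : ℕ) : Set (ProjSpace k) :=
  ⋃₀ {Z | f.IsPrimitive n Z}

/-- The heights of the primitive degree lowering hypersurfaces. -/
def primitiveHeights (f : DominatingMap k) : Set ℕ := {n | ∃ Z, f.IsPrimitive n Z}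

theorem finite_isPrimitive_height (f : DominatingMap k) (n : ℕ) : {Z | f.IsPrimitive n Z}.Finite :=
  f.finite_isPrimitive.subset fun _ hZ => ⟨n, hZ⟩

/-- Send `n` to the set of primitive hypersurfaces of height `n`. The values are subsets of a finite
set, and a common member forces two heights to coincide. -/
theorem finite_primitiveHeights (f : DominatingMap k) : f.primitiveHeights.Finite := by
  refine Set.Finite.of_finite_fibers (f := fun n => {Z | f.IsPrimitive n Z}) ?_ ?_
  · refine f.finite_isPrimitive.finite_subsets.subset ?_
    rintro _ ⟨n, -, rfl⟩ Z hZ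
    exact ⟨n, hZ⟩
  · rintro _ ⟨n, ⟨Z, hZ⟩, rfl⟩
    refine (Set.finite_singleton n).subset fun m hm => ?_
    have hZm : f.IsPrimitive m Z := hm.2.symm.subset hZ
    exact hZm.height.unique hZ.height

theorem isComponent_primitiveUnion (f : DominatingMap k) {n : ℕ} {Z : Set (ProjSpace k)}
    (h : IsComponent Z (f.primitiveUnion n)) : f.IsPrimitive n Z := by
  obtain ⟨B, hB, hZB⟩ := exists_subset_of_subset_sUnion (f.finite_isPrimitive_height n)
    (fun B hB => hB.isClosed) h.1.1 h.1.2
  rwa [hZB.antisymm (h.2 ⟨hB.irreducible, Set.subset_sUnion_of_mem hB⟩ hZB)]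

theorem isDegreeLowering_primitiveUnion (f : DominatingMap k) {n : ℕ}
    (hn : n ∈ f.primitiveHeights) : f.IsDegreeLowering (f.primitiveUnion n) n := by
  obtain ⟨Z, hZ⟩ := hn
  have hfin := f.finite_isPrimitive_height n
  have hsub : ∀ m, f.iterImage m (f.primitiveUnion n) ⊆ f.indet ↔
      ∀ Y, f.IsPrimitive n Y → f.iterImage m Y ⊆ f.indet := fun m => by
    rw [primitiveUnion, iterImage_sUnion f m hfin, Set.iUnion₂_subset_iff]
    rfl
  refine ⟨⟨?_,
    hZ.irreducible.nonempty.mono (Set.subset_sUnion_of_mem hZ),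
    fun Y hY => (f.isComponent_primitiveUnion hY).codim_eq⟩,
    ⟨hZ.height.1.1, (hsub n).2 fun Y hY => hY.height.1.2⟩, fun m hm => ?_⟩
  · rw [primitiveUnion, Set.sUnion_eq_biUnion]
    exact hfin.isClosed_biUnion fun Y hY => hY.isClosed
  exact hZ.height.2 ⟨hm.1, (hsub m).1 hm.2 Z hZ⟩

/-- The union is finite, so each irreducible closed subset of its image lies in the image of a
single member. -/
theorem one_lt_codim_iterImage_primitiveUnion (f : DominatingMap k) {m n : ℕ} (h1 : 1 ≤ m)
    (h2 : m ≤ n) : 1 < codim (f.iterImage m (f.primitiveUnion n)) := by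
  have : (2 : ℕ∞) ≤ codim (f.iterImage m (f.primitiveUnion n)) := by
    refine le_iInf₂ fun Z hZ => ?_
    rw [← codim_eq_coheight]
    have hfin := f.finite_isPrimitive_height n
    rw [primitiveUnion, iterImage_sUnion f m hfin, ← Set.sUnion_image] at hZ
    obtain ⟨_, ⟨Y, hY, rfl⟩, hZY⟩ := exists_subset_of_subset_sUnion (hfin.image _)
      (by rintro _ ⟨Y, hY, rfl⟩; exact f.isClosed_iterImage m hY.isClosed) Z.isIrreducible hZ
    rw [← one_add_one_eq_two]
    exact (Order.add_one_le_of_lt (hY.codim_image m h1 h2)).trans (codim_anti hZY)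
  exact lt_of_lt_of_le (by decide) this

/-- The last image of codimension one of an irreducible degree lowering hypersurface is
primitive. -/
theorem exists_isPrimitive_iterImage (f : DominatingMap k) {A : Set (ProjSpace k)} {h : ℕ}
    (hA : IsIrreducible A) (hdl : f.IsDegreeLowering A h) :
    ∃ m < h, f.IsPrimitive (h - m) (f.iterImage m A) := by
  classical
  obtain ⟨hhyp, ⟨hh1, hh2⟩, hmin⟩ := hdl
  have hc := hhyp.1
  have hcodim := (isHypersurface_iff hA hc).1 hhyp
  -- The height only concerns times `l ≥ 1`; at time `0` the codimension of `I(f)` decides.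
  have hns : ∀ l < h, ¬ f.iterImage l A ⊆ f.indet := by
    intro l hl hsub
    rcases Nat.eq_zero_or_pos l with rfl | hpos
    · exact not_subset_indet_of_codim_eq hcodim hsub
    · exact absurd (hmin ⟨hpos, hsub⟩) (not_le.2 hl)
  have hlift : ∀ l ≤ h, f.LiftNonzero l A := fun l hl =>
    f.liftNonzero_of_forall_lt hA fun i hi => hns i (hi.trans_le hl)
  have hirr : ∀ l ≤ h, IsIrreducible (f.iterImage l A) := fun l hl =>
    f.isIrreducible_iterImage hA (hlift l hl)
  have hcomp : ∀ l i, l + i ≤ h → f.iterImage i (f.iterImage l A) = f.iterImage (l + i) A :=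
    fun l i hli => f.iterImage_iterImage hA hc (hlift l (by omega)) (hlift _ hli)
  -- An image equal to the whole space would remain so until time `h`, when it must lie in `I(f)`.
  have hne0 : ∀ l ≤ h, codim (f.iterImage l A) ≠ 0 := by
    intro l hl h0
    rw [codim_eq_zero_iff (hirr l hl) (f.isClosed_iterImage l hc)] at h0
    have h1 := hcomp l (h - l) (by omega)
    rw [h0, iterImage_univ, Nat.add_sub_cancel' hl] at h1
    rw [← h1] at hh2
    have h2 := f.one_lt_codim_of_subset_indet hh2
    rw [(codim_eq_zero_iff isIrreducible_univ isClosed_univ).2 rfl] at h2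
    exact absurd h2 (by decide)
  let P : ℕ → Prop := fun l => codim (f.iterImage l A) = 1
  have hP0 : P 0 := hcodim
  -- The last time before `h` at which the image has codimension one; all later images up to time
  -- `h` have codimension at least two.
  set m := Nat.findGreatest P (h - 1) with hm
  have hPm : P m := Nat.findGreatest_spec (Nat.zero_le _) hP0
  have hmh : m ≤ h - 1 := Nat.findGreatest_le _
  have hgt : ∀ l, m < l → l ≤ h → 1 < codim (f.iterImage l A) := by
    intro l hml hlh
    rcases hlh.lt_or_eq with hlt | rfl
    · have h1 : ¬ P l := Nat.findGreatest_is_greatest hml (by omega)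
      exact lt_of_le_of_ne (Order.one_le_iff_ne_zero.2 (hne0 l hlh)) (Ne.symm h1)
    · exact f.one_lt_codim_of_subset_indet hh2
  refine ⟨m, by omega,
    ⟨hirr m (by omega), f.isClosed_iterImage m hc, hPm, ⟨⟨by omega, ?_⟩, ?_⟩, ?_⟩⟩
  · rwa [hcomp m (h - m) (by omega), Nat.add_sub_cancel' (by omega)]
  · rintro i ⟨hi1, hi2⟩
    by_contra! hlt
    rw [hcomp m i (by omega)] at hi2
    exact hns (m + i) (by omega) hi2
  · intro i hi1 hi2
    rw [hcomp m i (by omega)]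
    exact hgt _ (by omega) (by omega)

/-- The unions of the primitive degree lowering hypersurfaces of equal height form a primitive
family. -/
theorem isPrimitiveFamily_primitiveUnion (f : DominatingMap k) {M : ℕ} {n : Fin M → ℕ}
    (hn : Function.Injective n) (hrange : Set.range n = f.primitiveHeights) :
    f.IsPrimitiveFamily M (fun j => f.primitiveUnion (n j)) n where
  degreeLowering j := f.isDegreeLowering_primitiveUnion (hrange ▸ Set.mem_range_self j)
  component _ _ hZ := (f.isComponent_primitiveUnion hZ).height
  injective := hn
  codim _ _ h1 h2 := f.one_lt_codim_iterImage_primitiveUnion h1 h2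
  lands A h hA hdl := by
    obtain ⟨m, hmh, hm⟩ := f.exists_isPrimitive_iterImage hA hdl
    obtain ⟨j, hj⟩ : h - m ∈ Set.range n := hrange ▸ ⟨_, hm⟩
    refine ⟨m, hmh, j, (isHypersurface_iff hm.irreducible hm.isClosed).2 hm.codim_eq, ?_⟩
    rw [hj]
    exact Set.subset_sUnion_of_mem hm

/-! ### Uniqueness of primitive families and algebraic stability -/

namespace IsPrimitiveFamily

variable {f : DominatingMap k} {M : ℕ} {H : Fin M → Set (ProjSpace k)} {n : Fin M → ℕ}

theorem isPrimitive_of_isComponent (h : f.IsPrimitiveFamily M H n) {j : Fin M}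
    {Z : Set (ProjSpace k)} (hZ : IsComponent Z (H j)) : f.IsPrimitive (n j) Z where
  irreducible := hZ.1.1
  isClosed := hZ.isClosed (h.degreeLowering j).1.1
  codim_eq := (h.degreeLowering j).1.2.2 Z hZ
  height := h.component j Z hZ
  codim_image m h1 h2 :=
    (h.codim j m h1 h2).trans_le (codim_anti (f.iterImage_mono m hZ.1.2))

/-- The landing time given by `lands` must be `0`, since the later images of `Z` before its height
have codimension above one. So `Z` lies in some component of `H j`, and equal codimension forces
equality. -/
theorem exists_isComponent_of_isPrimitive (h : f.IsPrimitiveFamily M H n) {l : ℕ}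
    {Z : Set (ProjSpace k)} (hZ : f.IsPrimitive l Z) : ∃ j, n j = l ∧ IsComponent Z (H j) := by
  obtain ⟨m, hml, j, hhyp, hsub⟩ := h.lands Z l hZ.irreducible
    ⟨(isHypersurface_iff hZ.irreducible hZ.isClosed).2 hZ.codim_eq, hZ.height⟩
  have hm : m = 0 := by
    by_contra hm
    have hirr : IsIrreducible (f.iterImage m Z) := by
      refine f.isIrreducible_iterImage hZ.irreducible
        (f.liftNonzero_of_forall_lt hZ.irreducible fun i hi hsub => ?_)
      rcases Nat.eq_zero_or_pos i with rfl | hpos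
      · exact not_subset_indet_of_codim_eq hZ.codim_eq hsub
      · exact absurd (hZ.height.2 ⟨hpos, hsub⟩) (by omega)
    have h1 := hZ.codim_image m (Nat.one_le_iff_ne_zero.2 hm) hml.le
    rw [(isHypersurface_iff hirr hhyp.1).1 hhyp] at h1
    exact lt_irrefl _ h1
  subst hm
  obtain ⟨Y, hY, hZY⟩ := exists_isComponent hZ.irreducible hsub
  have hYp := h.isPrimitive_of_isComponent hY
  obtain rfl := eq_of_subset_of_codim_eq hZ.irreducible hZ.isClosed hYp.irreducible hYp.isClosed
    hZ.codim_eq hYp.codim_eq hZY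
  exact ⟨j, hYp.height.unique hZ.height, hY⟩

theorem eq_primitiveUnion (h : f.IsPrimitiveFamily M H n) (j : Fin M) :
    H j = f.primitiveUnion (n j) := by
  refine Set.Subset.antisymm (fun x hx => ?_) (Set.sUnion_subset fun Z hZ => ?_)
  · obtain ⟨Z, hZ, hxZ⟩ := exists_isComponent (isIrreducible_singleton (x := x))
      (Set.singleton_subset_iff.2 hx)
    exact ⟨Z, h.isPrimitive_of_isComponent hZ, hxZ rfl⟩
  · obtain ⟨i, hi, hZi⟩ := h.exists_isComponent_of_isPrimitive hZ
    -- Distinctness of the heights is essential here: it keeps primitive hypersurfaces of the same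
    -- height in a single member.
    obtain rfl := h.injective hi
    exact hZi.1.2

theorem range_eq (h : f.IsPrimitiveFamily M H n) : Set.range n = f.primitiveHeights := by
  ext l
  constructor
  · rintro ⟨j, rfl⟩
    obtain ⟨x, hx⟩ := (h.degreeLowering j).1.2.1
    obtain ⟨Z, hZ, -⟩ := exists_isComponent (isIrreducible_singleton (x := x))
      (Set.singleton_subset_iff.2 hx)
    exact ⟨Z, h.isPrimitive_of_isComponent hZ⟩
  · rintro ⟨Z, hZ⟩
    obtain ⟨j, hj, -⟩ := h.exists_isComponent_of_isPrimitive hZ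
    exact ⟨j, hj⟩

theorem unique (h : f.IsPrimitiveFamily M H n) {M' : ℕ} {H' : Fin M' → Set (ProjSpace k)}
    {n' : Fin M' → ℕ} (h' : f.IsPrimitiveFamily M' H' n') :
    M' = M ∧ ∃ e : Fin M' ≃ Fin M, ∀ j, H' j = H (e j) ∧ n' j = n (e j) := by
  -- Both families have the same set of heights, so indices are matched by height.
  let e : Fin M' ≃ Fin M := (Equiv.ofInjective n' h'.injective).trans
    ((Equiv.setCongr (h'.range_eq.trans h.range_eq.symm)).trans
      (Equiv.ofInjective n h.injective).symm)
  have he : ∀ j, n' j = n (e j) := fun j =>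
    (Equiv.apply_ofInjective_symm h.injective
      ⟨n' j, h.range_eq.symm ▸ h'.range_eq ▸ Set.mem_range_self j⟩).symm
  refine ⟨by simpa using Fintype.card_congr e, e, fun j => ⟨?_, he j⟩⟩
  rw [h'.eq_primitiveUnion, h.eq_primitiveUnion, he]

theorem isAlgebraicallyStable_iff (h : f.IsPrimitiveFamily M H n) :
    f.IsAlgebraicallyStable ↔ M = 0 := by
  classical
  constructor
  · intro hs
    by_contra hM
    have hdl := h.degreeLowering ⟨0, Nat.pos_of_ne_zero hM⟩
    exact hs ⟨_, _, hdl.1, hdl.2.1⟩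
  · rintro rfl ⟨A, N, hA, hN⟩
    obtain ⟨x, hx⟩ := hA.2.1
    -- `lands` speaks of irreducible hypersurfaces, so pass to a component; its height may be
    -- smaller than `N`.
    obtain ⟨Z, hZ, -⟩ := exists_isComponent (isIrreducible_singleton (x := x))
      (Set.singleton_subset_iff.2 hx)
    have hex : ∃ m, 1 ≤ m ∧ f.iterImage m Z ⊆ f.indet :=
      ⟨N, hN.1, (f.iterImage_mono N hZ.1.2).trans hN.2⟩
    obtain ⟨-, -, j, -⟩ := h.lands Z (Nat.find hex) hZ.1.1
      ⟨(isHypersurface_iff hZ.1.1 (hZ.isClosed hA.1)).2 (hA.2.2 Z hZ), Nat.find_spec hex,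
        fun m hm => Nat.find_min' hex hm⟩
    exact j.elim0

end IsPrimitiveFamily

end DominatingMap

end

theorem mainTheorem3 (k : ℕ) (hk : 2 ≤ k) (f : DominatingMap k) :
    ∃ (M : ℕ) (H : Fin M → Set (ProjSpace k)) (n : Fin M → ℕ),
      f.IsPrimitiveFamily M H n ∧
      (∀ (M' : ℕ) (H' : Fin M' → Set (ProjSpace k)) (n' : Fin M' → ℕ),
        f.IsPrimitiveFamily M' H' n' →
          M' = M ∧ ∃ e : Fin M' ≃ Fin M, ∀ j, H' j = H (e j) ∧ n' j = n (e j)) ∧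
      (f.IsAlgebraicallyStable ↔ M = 0) := by
  classical
  -- `M` is the number of distinct primitive heights, and `n` enumerates them.
  let s := f.finite_primitiveHeights.toFinset
  let n : Fin s.card → ℕ := fun j => s.equivFin.symm j
  have hn : Function.Injective n := Subtype.val_injective.comp s.equivFin.symm.injective
  have hrange : Set.range n = f.primitiveHeights := by
    rw [show n = Subtype.val ∘ s.equivFin.symm from rfl, EquivLike.range_comp]
    simp [s]
  have h := f.isPrimitiveFamily_primitiveUnion hn hrange
  exact ⟨_, _, n, h, fun _ _ _ h' => h.unique h', h.isAlgebraicallyStable_iff⟩
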